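/- Let $n\ge 1$ and $0\le k\le n$, $W=S_n$ with simple transpositions $s_i=(i\ i{+}1)$ and length function $\ell$ (number of inversions), $W_K=\langle s_i : i\ne k\rangle$, and let $w_K$ be the longest element of $W_K$. Let $w\in W$ have a length-additive factorization $w=xw_K$, $\ell(w)=\ell(x)+\ell(w_K)$, where $x$ is of minimal length in its coset $xW_K$. **Young diagrams.** A Young diagram $\mu$ inside the $k\times(n-k)$ rectangle (upper left justified) is cut out by a lattice path of $n$ unit steps east and north from the southwest to the northeast corner of the rectangle; $\mathrm{vert}(\mu)\subseteq[n]$ is the set of positions of the north steps. This is a bijection onto the $k$-subsets of $[n]$, and $\mathrm{vert}(\emptyset)=[k]$. Let $\lambda$ be the Young diagram with $\mathrm{vert}(\lambda)=x([k])$. For a box $b$ of $\lambda$, let $\mathrm{Rect}(b)$ be the largest rectangle contained in $\lambda$ with lower right corner $b$; it is called $\lambda$-frozen if $b$ touches the south or east boundary of $\lambda$ along an edge or at its southeast corner, i.e. if the box diagonally southeast of $b$ is not in $\lambda$. **Columnar expression.** Fill the box of $\lambda$ in row $p$ and column $q$ with $s_{k+q-p}$ and read the columns of $\lambda$ from top to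 bottom, moving from left to right, to get $s_{i_1},s_{i_2},\dots,s_{i_r}$. The columnar expression for $x$ is $\mathbf x=s_{i_r}\cdots s_{i_1}$. Let $\mathbf w=\mathbf x\mathbf w_K$ be a standard reduced expression for $w$, i.e. a reduced expression in which $\mathbf w_K$ is an arbitrary reduced expression for $w_K$. **Plabic graphs and target labels.** A plabic graph is a planar graph in a disk, with internal vertices coloured black and white and boundary vertices $1,\dots,n$ in clockwise order, each adjacent to exactly one internal vertex. The trip from $i$ turns maximally right at black and maximally left at white vertices until it reaches a boundary vertex $\pi(i)$. The target label of a face is the set of all $j=\pi(i)$ such that either $i\neq j$ and the face lies to the left of the trip from $i$ to $j$, or $i=j$ and the internal vertex adjacent to $j$ is white. A boundary vertex is a lollipop if its adjacent internal vertex is a leaf. Put $\tilde\pi(i)=\pi(i)$ if $\pi(i)>i$ or $i$ is a fixed point adjacent to a black vertex, and $\tilde\pi(i)=\pi(i)+n$ otherwise. For $a<b$, the $(a\ b)$-bridge is valid if $\tilde\pi(a)>\tilde\pi(b)$, all boundary vertices strictly between $a$ and $b$ are lollipops, and $a$ (resp. $b$), if it is a lollipop, is white (resp. black). To add it, place a white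 (resp. black) vertex in the middle of the edge at $a$ (resp. $b$), using the leaf instead if $a$ (resp. $b$) is a lollipop, join these two vertices by an edge, and add vertices of degree two as necessary to make the graph bipartite. **The bridge graph.** Let $B_{w_K,\mathbf w}$ be the plabic graph obtained from the lollipop graph with white lollipops $[k]$ and black lollipops $[k+1,n]$ by successively adding the bridges $s_{i_1},s_{i_2},\dots,s_{i_r}$, where $s_i$ stands for the $(i\ i{+}1)$-bridge. **Statement.** Each of these bridges is valid when it is added, and the set of target face labels of $B_{w_K,\mathbf w}$ is exactly $$\{\mathrm{vert}(\mathrm{Rect}(b)) : b \text{ a box of } \lambda\}\cup\{[k]\}.$$ The target labelling restricts to a bijection from the set of faces of $B_{w_K,\mathbf w}$ incident to the boundary of the disk onto $$\{\mathrm{vert}(\mathrm{Rect}(b)) : b \text{ a box of } \lambda,\ \mathrm{Rect}(b)\ \lambda\text{-frozen}\}\cup\{[k]\};$$ that is, the boundary faces correspond to the $\lambda$-frozen rectangles together with the empty rectangle. -/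

import Mathlib

/-! Conventions: `Fin n = {0, …, n-1}` stands for `[n] = {1, …, n}`, so the element `i : Fin n` is
the integer `i + 1` of the usual notation.  Boxes of Young diagrams are pairs (row, column), counted
from `0`, rows from top to bottom and columns from left to right. -/

/-! ### Permutations -/

/-- The simple transposition of the `0`-based positions `j` and `j + 1`, which is `s_{j+1}` in
the usual `1`-based notation (the identity if `n ≤ j + 1`; such letters are not used). -/
def simpleTransposition (n j : ℕ) : Equiv.Perm (Fin n) :=
  if h : j + 1 < n then Equiv.swap ⟨j, by omega⟩ ⟨j + 1, h⟩ else 1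

/-- The length `ℓ(w)` of a permutation: its number of inversions. -/
def permLength {n : ℕ} (w : Equiv.Perm (Fin n)) : ℕ :=
  ((Finset.univ : Finset (Fin n × Fin n)).filter fun p => p.1 < p.2 ∧ w p.2 < w p.1).card

/-- The parabolic subgroup `W_K` generated by all simple transpositions except `s_k`. -/
def parabolicSubgroup (n k : ℕ) : Subgroup (Equiv.Perm (Fin n)) :=
  Subgroup.closure {s | ∃ j, j + 1 < n ∧ j + 1 ≠ k ∧ s = simpleTransposition n j}

/-- `wK` is the longest element of `W_K`. -/
def IsLongestParabolic (n k : ℕ) (wK : Equiv.Perm (Fin n)) : Prop :=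
  wK ∈ parabolicSubgroup n k ∧ ∀ u ∈ parabolicSubgroup n k, permLength u ≤ permLength wK

/-- `x` belongs to `ᴷW`: it has minimal length in its coset `x W_K`. -/
def IsMinimalCosetRep (n k : ℕ) (x : Equiv.Perm (Fin n)) : Prop :=
  ∀ u ∈ parabolicSubgroup n k, permLength x ≤ permLength (x * u)

/-- The product, from left to right, of a word in the simple transpositions. -/
def wordProd (n : ℕ) (l : List ℕ) : Equiv.Perm (Fin n) :=
  (l.map (simpleTransposition n)).prod

/-- `l` is a reduced expression for `w`. -/
def IsReducedExpression (n : ℕ) (l : List ℕ) (w : Equiv.Perm (Fin n)) : Prop :=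
  (∀ j ∈ l, j + 1 < n) ∧ wordProd n l = w ∧ l.length = permLength w

/-! ### Young diagrams, subsets and columnar expressions -/

/-- The Young diagram of a subset `I` of `[n]`.  Walk from the southwest corner to the northeast
corner of the `|I| × (n - |I|)` rectangle, the `i`-th step being north if `i ∈ I` and east otherwise;
the diagram lies to the northwest of this path.  Column `c` thus has as many boxes as there are north
steps preceded by more than `c` east steps. -/
def diagramOfSubset {n : ℕ} (I : Finset (Fin n)) : YoungDiagram where
  cells := (Finset.range n ×ˢ Finset.range n).filter fun b =>
    b.1 < (I.filter fun i => b.2 < (Finset.univ.filter fun m => m ∉ I ∧ m < i).card).card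
  isLowerSet := by
    rintro ⟨r, c⟩ ⟨r', c'⟩ ⟨hr, hc⟩ h
    simp only [Finset.coe_filter, Finset.mem_product, Finset.mem_range, Set.mem_ofPred_eq] at h ⊢
    simp only at hr hc
    refine ⟨⟨by omega, by omega⟩, lt_of_le_of_lt hr (lt_of_lt_of_le h.2 (Finset.card_le_card ?_))⟩
    intro i hi
    simp only [Finset.mem_filter] at hi ⊢
    exact ⟨hi.1, lt_of_le_of_lt hc hi.2⟩

/-- The vertical steps of a Young diagram contained in the `k × (n - k)` rectangle: the set of
positions of the north steps on the lattice path from the southwest corner to the northeast corner of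
the rectangle which cuts out the diagram.  The north step in row `r` is preceded by the `k - 1 - r`
north steps in the lower rows and by as many east steps as row `r` has boxes. -/
def verticalSteps (n k : ℕ) (μ : YoungDiagram) : Set (Fin n) :=
  {i | ∃ r < k, (i : ℕ) = μ.rowLen r + (k - 1 - r)}

/-- The set `[k]` inside `[n]`. -/
def initialSegment (n k : ℕ) : Finset (Fin n) := Finset.univ.filter fun i => (i : ℕ) < k

/-- The rectangle whose upper left corner is the corner of the diagram and whose lower right
corner is the box `b`; it is the largest rectangle with lower right corner `b` contained in any
Young diagram containing `b`. -/
def rectOfBox (b : ℕ × ℕ) : YoungDiagram where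
  cells := Finset.range (b.1 + 1) ×ˢ Finset.range (b.2 + 1)
  isLowerSet := by
    rintro ⟨r, c⟩ ⟨r', c'⟩ ⟨hr, hc⟩ h
    simp only [Finset.coe_product, Set.mem_prod, Finset.coe_range, Set.mem_Iio] at h hr hc ⊢
    omega

/-- The box `b` of `μ` touches the south or east boundary of `μ`, along an edge or at its
southeast corner; that is, the box diagonally southeast of `b` is not in `μ`. -/
def IsFrozenBox (μ : YoungDiagram) (b : ℕ × ℕ) : Prop :=
  b ∈ μ ∧ (b.1 + 1, b.2 + 1) ∉ μ

/-- The simple transpositions filling the boxes of `μ`, read down the columns, columns from left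
to right.  In `1`-based notation the box in row `r` and column `c` is filled with `s_{k+c-r}`. -/
def columnarReading (k : ℕ) (μ : YoungDiagram) : List ℕ :=
  (List.range (μ.rowLen 0)).flatMap fun c =>
    (List.range (μ.colLen c)).map fun r => k + c - (r + 1)

/-- The Young diagram of `x([k])`. -/
def diagramOfPerm {n : ℕ} (k : ℕ) (x : Equiv.Perm (Fin n)) : YoungDiagram :=
  diagramOfSubset ((initialSegment n k).image x)

/-- The columnar expression for `x`: the columnar reading written from right to left. -/
def columnarExpression {n : ℕ} (k : ℕ) (x : Equiv.Perm (Fin n)) : List ℕ :=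
  (columnarReading k (diagramOfPerm k x)).reverse

/-- `ws` is a standard reduced expression for `w = x w_K`: a reduced expression for `w` that consists
of the columnar expression for `x` followed by an arbitrary reduced expression for `w_K`. -/
def IsStandardReducedExpression {n : ℕ} (k : ℕ) (x wK w : Equiv.Perm (Fin n)) (ws : List ℕ) :
    Prop :=
  IsReducedExpression n ws w ∧
    ∃ us, IsReducedExpression n us wK ∧ ws = columnarExpression k x ++ us

/-! ### Bicolored graphs in a disk -/

/-- A bicolored graph drawn in an oriented disk, up to homotopy, encoded by its rotation system.
There are `n` boundary vertices, numbered clockwise along the boundary circle, each of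
degree one and adjacent to an internal vertex.  An edge is a pair of opposite darts (oriented
edges); a vertex is identified with the set of darts leaving it, which is a cycle of `rot`.
(The plabic graphs below are built from a graph of lollipops by two operations that can be
carried out inside the disk without crossings, so they are planar.) -/
structure PlabicGraph (n : ℕ) where
  /-- The darts. -/
  Dart : Type
  [fintypeDart : Fintype Dart]
  [decEqDart : DecidableEq Dart]
  /-- The opposite dart of the same edge. -/
  rev : Equiv.Perm Dart
  rev_rev : ∀ d, rev (rev d) = d
  rev_ne : ∀ d, rev d ≠ d
  /-- The next dart, counterclockwise, leaving the same vertex. -/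
  rot : Equiv.Perm Dart
  /-- The unique dart leaving the `i`-th boundary vertex. -/
  bdry : Fin n ↪ Dart
  rot_bdry : ∀ i, rot (bdry i) = bdry i
  rev_bdry : ∀ i j, rev (bdry i) ≠ bdry j
  /-- The colour (`true` is white, `false` is black) of the internal vertex which a dart leaves; the
  value on `bdry i` is irrelevant. -/
  white : Dart → Bool
  white_rot : ∀ d, white (rot d) = white d

namespace PlabicGraph

attribute [instance] fintypeDart decEqDart

variable {n : ℕ}

/-- The dart towards the `i`-th boundary vertex, leaving the internal vertex adjacent to it. -/
def nbr (G : PlabicGraph n) (i : Fin n) : G.Dart := G.rev (G.bdry i)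

/-- The `i`-th boundary vertex is adjacent to an internal vertex of degree one. -/
def IsLollipop (G : PlabicGraph n) (i : Fin n) : Prop := G.rot (G.nbr i) = G.nbr i

instance (G : PlabicGraph n) (i : Fin n) : Decidable (G.IsLollipop i) :=
  inferInstanceAs (Decidable (G.rot (G.nbr i) = G.nbr i))

/-! #### Faces -/

/-- Two consecutive darts on the boundary of a face, which lies to the left of both of them.
On arriving at an internal vertex one takes the leftmost continuation.  On arriving at a boundary
vertex one follows the boundary circle counterclockwise to the preceding boundary vertex, and
leaves it along its edge. -/
inductive FaceStep (G : PlabicGraph n) : G.Dart → G.Dart → Prop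
  | internal (d : G.Dart) (h : G.rev d ∉ Set.range G.bdry) : FaceStep G d (G.rot.symm (G.rev d))
  | boundary (i : Fin n) : FaceStep G (G.nbr (finRotate n i)) (G.bdry i)

/-- The faces of `G`, that is, the regions into which `G` cuts the disk. -/
def Face (G : PlabicGraph n) : Type := Quot G.FaceStep

/-- The face to the left of a dart. -/
def leftFace (G : PlabicGraph n) (d : G.Dart) : G.Face := Quot.mk _ d

/-- The faces incident to the boundary of the disk: those containing the arc of the boundary circle
from the `i`-th boundary vertex to the next one, for some `i`. -/
def boundaryFaces (G : PlabicGraph n) : Set G.Face := Set.range fun i => G.leftFace (G.bdry i)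

/-! #### Trips and target labels -/

/-- The darts of the trip starting at the boundary vertex `i`, according to the rules of the road:
turn maximally left at white vertices and maximally right at black vertices, until a
boundary vertex is reached. -/
inductive OnTrip (G : PlabicGraph n) (i : Fin n) : G.Dart → Prop
  | start : OnTrip G i (G.bdry i)
  | left (d : G.Dart) (hd : OnTrip G i d) (h : G.rev d ∉ Set.range G.bdry)
      (hw : G.white (G.rev d) = true) : OnTrip G i (G.rot.symm (G.rev d))
  | right (d : G.Dart) (hd : OnTrip G i d) (h : G.rev d ∉ Set.range G.bdry)
      (hb : G.white (G.rev d) = false) : OnTrip G i (G.rot (G.rev d))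

/-- The trip starting at `i` ends at `j`; that is, the trip permutation maps `i` to `j`. -/
def TripEndsAt (G : PlabicGraph n) (i j : Fin n) : Prop := G.OnTrip i (G.nbr j)

/-- The faces to the left of the trip starting at `i`: the faces immediately to the left of a dart
of the trip, and all faces which can be reached from these without crossing the trip. -/
inductive LeftOfTrip (G : PlabicGraph n) (i : Fin n) : G.Face → Prop
  | adjacent (d : G.Dart) (hd : G.OnTrip i d) : LeftOfTrip G i (G.leftFace d)
  | cross (d : G.Dart) (hd : ¬ G.OnTrip i d) (hd' : ¬ G.OnTrip i (G.rev d))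
      (h : LeftOfTrip G i (G.leftFace d)) : LeftOfTrip G i (G.leftFace (G.rev d))

/-- The target label of a face.  The trip from `i` to `j` contributes `j` to the faces on its left
if `i ≠ j`; if `i = j` it contributes `j` to all faces or to none, according to whether
the vertex adjacent to the boundary vertex `j` is white or black. -/
def targetLabel (G : PlabicGraph n) (f : G.Face) : Set (Fin n) :=
  {j | ∃ i, G.TripEndsAt i j ∧
    ((i ≠ j ∧ G.LeftOfTrip i f) ∨ (i = j ∧ G.white (G.nbr j) = true))}

/-! #### Bridges -/

/-- The value at `i` of the bounded affine permutation of `G`, if the trip permutation maps `i` to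
`j` (the fixed points being coloured as the adjacent vertices): `n` is added to antiexcedances. -/
def affineValue (G : PlabicGraph n) (i j : Fin n) : ℕ :=
  if i < j ∨ (i = j ∧ G.white (G.nbr i) = false) then (j : ℕ) else (j : ℕ) + n

/-- The `(a b)`-bridge is valid for `G`. -/
def IsValidBridge (G : PlabicGraph n) (a b : Fin n) : Prop :=
  a < b ∧
  (∃ i j, G.TripEndsAt a i ∧ G.TripEndsAt b j ∧ G.affineValue b j < G.affineValue a i) ∧
  (∀ c, a < c → c < b → G.IsLollipop c) ∧
  (G.IsLollipop a → G.white (G.nbr a) = true) ∧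
  (G.IsLollipop b → G.white (G.nbr b) = false)

/-- Place a new vertex of degree two in the middle of the edge adjacent to the boundary vertex `a`,
with the colour opposite to that of the internal vertex on this edge.  The new darts `inr true` and
`inr false` leave the new vertex towards the boundary and away from it. -/
def subdivide (G : PlabicGraph n) (a : Fin n) : PlabicGraph n where
  Dart := G.Dart ⊕ Bool
  rev := Equiv.swap (Sum.inl (G.nbr a)) (Sum.inr true) *
    Equiv.Perm.sumCongr G.rev (Equiv.swap true false) *
    Equiv.swap (Sum.inl (G.nbr a)) (Sum.inr true)
  rev_rev d := by
    have h : ∀ e, Equiv.Perm.sumCongr G.rev (Equiv.swap true false)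
        (Equiv.Perm.sumCongr G.rev (Equiv.swap true false) e) = e := by
      rintro (e | e) <;> simp [G.rev_rev]
    simp only [Equiv.Perm.mul_apply, Equiv.swap_apply_self, h]
  rev_ne d := by
    have h : ∀ e, Equiv.Perm.sumCongr G.rev (Equiv.swap true false) e ≠ e := by
      rintro (e | e)
      · simp [G.rev_ne]
      · cases e <;> simp
    intro hd
    apply h (Equiv.swap (Sum.inl (G.nbr a)) (Sum.inr true) d)
    have := congrArg (Equiv.swap (Sum.inl (G.nbr a)) (Sum.inr true)) hd
    simpa using this
  rot := Equiv.Perm.sumCongr G.rot (Equiv.swap true false)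
  bdry := G.bdry.trans Function.Embedding.inl
  rot_bdry i := by simp [G.rot_bdry]
  rev_bdry i j := by
    have h1 : Equiv.swap (Sum.inl (G.nbr a)) (Sum.inr true) (Sum.inl (G.bdry i)) =
        (Sum.inl (G.bdry i) : G.Dart ⊕ Bool) :=
      Equiv.swap_apply_of_ne_of_ne (by simpa [nbr] using (G.rev_bdry a i).symm) (by simp)
    simp only [Function.Embedding.trans_apply, Function.Embedding.inl_apply, Equiv.Perm.mul_apply,
      h1, Equiv.Perm.sumCongr_apply, Sum.map_inl]
    intro h
    have h2 := congrArg (Equiv.swap (Sum.inl (G.nbr a)) (Sum.inr true)) h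
    rw [Equiv.swap_apply_self, Equiv.swap_apply_of_ne_of_ne
      (by simpa [nbr] using (G.rev_bdry a j).symm) (by simp)] at h2
    exact G.rev_bdry i j (Sum.inl_injective h2)
  white := Sum.elim G.white fun _ => ! G.white (G.nbr a)
  white_rot := by
    rintro (d | d) <;> simp [G.white_rot]

/-- Join the internal vertices adjacent to the boundary vertices `a` and `b` by a new edge, placed
next to the boundary: at the vertex adjacent to `a` the new dart `inr true` comes immediately
clockwise after the edge to `a`, at the vertex adjacent to `b` the new dart `inr false` comes
immediately counterclockwise after the edge to `b`. -/
def join (G : PlabicGraph n) (a b : Fin n) : PlabicGraph n where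
  Dart := G.Dart ⊕ Bool
  rev := Equiv.Perm.sumCongr G.rev (Equiv.swap true false)
  rev_rev := by rintro (e | e) <;> simp [G.rev_rev]
  rev_ne := by
    rintro (e | e)
    · simp [G.rev_ne]
    · cases e <;> simp
  rot := Equiv.swap (Sum.inr true) (Sum.inl (G.nbr a)) * Equiv.Perm.sumCongr G.rot 1 *
    Equiv.swap (Sum.inl (G.nbr b)) (Sum.inr false)
  bdry := G.bdry.trans Function.Embedding.inl
  rot_bdry i := by
    have h1 : Equiv.swap (Sum.inl (G.nbr b)) (Sum.inr false) (Sum.inl (G.bdry i)) =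
        (Sum.inl (G.bdry i) : G.Dart ⊕ Bool) :=
      Equiv.swap_apply_of_ne_of_ne (by simpa [nbr] using (G.rev_bdry b i).symm) (by simp)
    have h2 : Equiv.swap (Sum.inr true) (Sum.inl (G.nbr a)) (Sum.inl (G.bdry i)) =
        (Sum.inl (G.bdry i) : G.Dart ⊕ Bool) :=
      Equiv.swap_apply_of_ne_of_ne (by simp) (by simpa [nbr] using (G.rev_bdry a i).symm)
    simp [h1, h2, G.rot_bdry]
  rev_bdry i j := by
    simpa using G.rev_bdry i j
  white := Sum.elim G.white fun e => if e then G.white (G.nbr a) else G.white (G.nbr b)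
  white_rot := by
    set w : G.Dart ⊕ Bool → Bool :=
      Sum.elim G.white fun e => if e then G.white (G.nbr a) else G.white (G.nbr b) with hw
    have hs : ∀ (x y : G.Dart ⊕ Bool), w x = w y → ∀ d, w (Equiv.swap x y d) = w d := by
      intro x y hxy d
      rcases eq_or_ne d x with rfl | hx
      · simp [hxy]
      · rcases eq_or_ne d y with rfl | hy
        · simp [hxy]
        · rw [Equiv.swap_apply_of_ne_of_ne hx hy]
    intro d
    simp only [Equiv.Perm.mul_apply]
    rw [hs _ _ (by simp [hw])]
    have h3 : ∀ e, w (Equiv.Perm.sumCongr G.rot 1 e) = w e := by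
      rintro (e | e) <;> simp [hw, G.white_rot]
    rw [h3, hs _ _ (by simp [hw])]

/-- Provide the edge adjacent to `a` with an endpoint of a bridge of colour `c`.  The leaf is used if
`a` is a lollipop.  Otherwise a new vertex of colour `c` is placed on the edge, separated from the
old internal vertex by a vertex of the opposite colour if that vertex also has colour `c`. -/
def prepareBridge (G : PlabicGraph n) (a : Fin n) (c : Bool) : PlabicGraph n :=
  if G.IsLollipop a then G
  else if G.white (G.nbr a) = c then (G.subdivide a).subdivide a
  else G.subdivide a

/-- Add an `(a b)`-bridge to `G`, with a white vertex at `a` and a black vertex at `b`, together with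
the vertices of degree two needed to keep the graph bipartite. -/
def addBridge (G : PlabicGraph n) (a b : Fin n) : PlabicGraph n :=
  ((G.prepareBridge a true).prepareBridge b false).join a b

/-- The lollipop graph with white lollipops `[k]` and all other lollipops black. -/
def lollipopGraph (n k : ℕ) : PlabicGraph n where
  Dart := Fin n × Bool
  rev := Equiv.prodCongr (Equiv.refl _) (Equiv.swap true false)
  rev_rev := by rintro ⟨i, e⟩; simp
  rev_ne := by rintro ⟨i, e⟩; cases e <;> simp
  rot := 1
  bdry := ⟨fun i => (i, true), fun i j h => by simpa using h⟩
  rot_bdry i := rfl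
  rev_bdry i j h := by
    have h' := congrArg Prod.snd h
    change Equiv.swap true false true = true at h'
    simp at h'
  white d := decide ((d.1 : ℕ) < k)
  white_rot d := rfl

/-- The graph obtained from the lollipop graph by successively adding, for each letter `j` of the
list, the bridge between the consecutive (`0`-based) boundary vertices `j` and `j + 1`. -/
def ofBridgeSequence (n k : ℕ) (l : List ℕ) : PlabicGraph n :=
  l.foldl (fun G j => if h : j + 1 < n then G.addBridge ⟨j, by omega⟩ ⟨j + 1, h⟩ else G)
    (lollipopGraph n k)

/-- Each bridge of the sequence is valid for the graph to which it is added. -/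
def IsBridgeSequence (n k : ℕ) (l : List ℕ) : Prop :=
  ∀ (l' : List ℕ) (j : ℕ), l' ++ [j] <+: l →
    ∃ h : j + 1 < n, (ofBridgeSequence n k l').IsValidBridge ⟨j, by omega⟩ ⟨j + 1, h⟩

end PlabicGraph

/-- The bridge sequence given by a standard reduced expression `ws` for `x w_K`: the part of `ws`
which is left on removing the final reduced expression for `w_K`, read from right to left. -/
def bridgeSequence {n : ℕ} (wK : Equiv.Perm (Fin n)) (ws : List ℕ) : List ℕ :=
  (ws.rdrop (permLength wK)).reverse

/-- Karpman's bridge graph of the pair `(w_K, ws)`. -/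
def bridgeGraph {n : ℕ} (k : ℕ) (wK : Equiv.Perm (Fin n)) (ws : List ℕ) : PlabicGraph n :=
  PlabicGraph.ofBridgeSequence n k (bridgeSequence wK ws)

/-! ### Darts, trips and a local certificate for target labels -/

namespace PlabicGraph

variable {n : ℕ}

theorem rev_nbr (G : PlabicGraph n) (i : Fin n) : G.rev (G.nbr i) = G.bdry i := G.rev_rev _

theorem rev_bdry_eq_nbr (G : PlabicGraph n) (i : Fin n) : G.rev (G.bdry i) = G.nbr i := rfl

theorem nbr_ne_bdry (G : PlabicGraph n) (i j : Fin n) : G.nbr i ≠ G.bdry j := G.rev_bdry i j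

theorem nbr_injective (G : PlabicGraph n) : Function.Injective G.nbr :=
  G.rev.injective.comp G.bdry.injective

theorem nbr_notMem_range_bdry (G : PlabicGraph n) (i : Fin n) : G.nbr i ∉ Set.range G.bdry := by
  rintro ⟨j, h⟩
  exact G.nbr_ne_bdry i j h.symm

theorem rot_symm_bdry (G : PlabicGraph n) (i : Fin n) : G.rot.symm (G.bdry i) = G.bdry i := by
  rw [Equiv.symm_apply_eq, G.rot_bdry]

theorem white_rot_symm (G : PlabicGraph n) (d : G.Dart) : G.white (G.rot.symm d) = G.white d := by
  rw [← G.white_rot (G.rot.symm d), Equiv.apply_symm_apply]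

theorem rot_mem_range_bdry_iff (G : PlabicGraph n) (d : G.Dart) :
    G.rot d ∈ Set.range G.bdry ↔ d ∈ Set.range G.bdry := by
  constructor
  · rintro ⟨i, h⟩
    exact ⟨i, by rw [← G.rot_symm_bdry, h, Equiv.symm_apply_apply]⟩
  · rintro ⟨i, rfl⟩
    exact ⟨i, (G.rot_bdry i).symm⟩

theorem rot_symm_mem_range_bdry_iff (G : PlabicGraph n) (d : G.Dart) :
    G.rot.symm d ∈ Set.range G.bdry ↔ d ∈ Set.range G.bdry := by
  rw [← rot_mem_range_bdry_iff, Equiv.apply_symm_apply]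

theorem leftFace_eq_of_faceStep (G : PlabicGraph n) {d e : G.Dart} (h : G.FaceStep d e) :
    G.leftFace d = G.leftFace e := Quot.sound h

/-- `π` is the trip permutation of `G`, and `tgt d` is the target of the trip through the dart `d`. -/
structure IsTripTarget (G : PlabicGraph n) (π : Equiv.Perm (Fin n)) (tgt : G.Dart → Fin n) :
    Prop where
  tgt_bdry : ∀ i, tgt (G.bdry i) = π i
  tgt_nbr : ∀ i, tgt (G.nbr i) = i
  tgt_white : ∀ d, G.rev d ∉ Set.range G.bdry → G.white (G.rev d) = true →
    tgt (G.rot.symm (G.rev d)) = tgt d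
  tgt_black : ∀ d, G.rev d ∉ Set.range G.bdry → G.white (G.rev d) = false →
    tgt (G.rot (G.rev d)) = tgt d
  -- This excludes closed trips: every dart lies on a trip that starts at the boundary.
  onTrip : ∀ d, G.OnTrip (π.symm (tgt d)) d

/-- Besides the trips, `lab d` is the target label of the face to the left of the dart `d`, for a
graph in which the only fixed points of the trip permutation are lollipops, white exactly at the
boundary vertices in `[k]`.  The fields characterize `lab` locally. -/
structure IsTripLabelling (k : ℕ) (G : PlabicGraph n) (π : Equiv.Perm (Fin n))
    (tgt : G.Dart → Fin n) (lab : G.Dart → Set (Fin n)) : Prop extends IsTripTarget G π tgt where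
  lab_faceStep : ∀ d e, G.FaceStep d e → lab d = lab e
  lab_tgt : ∀ d, tgt d ≠ tgt (G.rev d) → tgt d ∈ lab d ∧ tgt d ∉ lab (G.rev d)
  lab_rev : ∀ d t, t ≠ tgt d → t ≠ tgt (G.rev d) → (t ∈ lab d ↔ t ∈ lab (G.rev d))
  tgt_eq_tgt_rev : ∀ d, tgt d = tgt (G.rev d) → ∃ i, π i = i ∧ (d = G.bdry i ∨ d = G.nbr i)
  lollipop_of_fixed : ∀ i, π i = i → G.IsLollipop i
  white_of_fixed : ∀ i, π i = i → (G.white (G.nbr i) = true ↔ (i : ℕ) < k)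
  mem_lab_of_fixed : ∀ i, π i = i → ∀ d, (i ∈ lab d ↔ (i : ℕ) < k)
  -- The half of the comparison with target labels that local conditions do not give: a label entry
  -- must be witnessed by a chain of crossings avoiding the trip.
  leftOfTrip : ∀ d t, t ∈ lab d → π t ≠ t → G.LeftOfTrip (π.symm t) (G.leftFace d)
  -- Used when a white lollipop receives a bridge: its index lies in every label, so every old face
  -- has to be reachable without crossing the trip that now ends there.
  connected : ∀ P : G.Face → Prop, (∀ d, P (G.leftFace d) → P (G.leftFace (G.rev d))) →
    ∀ f g, P f → P g

variable {k : ℕ} {G : PlabicGraph n} {π : Equiv.Perm (Fin n)} {tgt : G.Dart → Fin n}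
  {lab : G.Dart → Set (Fin n)}

namespace IsTripTarget

theorem tgt_of_onTrip (H : IsTripTarget G π tgt) {i : Fin n} {d : G.Dart}
    (h : G.OnTrip i d) : tgt d = π i := by
  induction h with
  | start => exact H.tgt_bdry i
  | left d _ h hw ih => rw [H.tgt_white d h hw, ih]
  | right d _ h hb ih => rw [H.tgt_black d h hb, ih]

/-- Trips are the fibres of `tgt`, so from here on membership in a trip is an equation between
targets. -/
theorem onTrip_iff (H : IsTripTarget G π tgt) (i : Fin n) (d : G.Dart) :
    G.OnTrip i d ↔ tgt d = π i := by
  refine ⟨H.tgt_of_onTrip, fun h => ?_⟩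
  simpa [h] using H.onTrip d

/-- A trip entering a leaf turns back at once, so it consists of the two darts of the lollipop's
edge. -/
theorem eq_or_eq_of_isLollipop (H : IsTripTarget G π tgt) {i : Fin n} (hi : G.IsLollipop i)
    (hf : π i = i) {d : G.Dart} (hd : tgt d = i) : d = G.bdry i ∨ d = G.nbr i := by
  have h0 : G.rot (G.nbr i) = G.nbr i := hi
  have h1 : G.rot.symm (G.nbr i) = G.nbr i := by rw [Equiv.symm_apply_eq, h0]
  have h2 := (H.onTrip_iff i d).2 (hd.trans hf.symm)
  clear hd
  induction h2 with
  | start => exact Or.inl rfl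
  | left d hd h hw ih =>
    rcases ih with rfl | rfl
    · exact Or.inr h1
    · exact absurd ⟨i, (G.rev_nbr i).symm⟩ h
  | right d hd h hw ih =>
    rcases ih with rfl | rfl
    · exact Or.inr h0
    · exact absurd ⟨i, (G.rev_nbr i).symm⟩ h

end IsTripTarget

namespace IsTripLabelling

theorem tripEndsAt_iff (H : IsTripLabelling k G π tgt lab) (i j : Fin n) :
    G.TripEndsAt i j ↔ π i = j := by
  rw [TripEndsAt, H.onTrip_iff, H.tgt_nbr, eq_comm]

theorem fixed_of_isLollipop (H : IsTripLabelling k G π tgt lab) {i : Fin n}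
    (h : G.IsLollipop i) : π i = i := by
  have h0 : G.rot (G.nbr i) = G.nbr i := h
  have h1 : G.rot.symm (G.nbr i) = G.nbr i := by rw [Equiv.symm_apply_eq, h0]
  rw [← H.tgt_bdry]
  cases hw : G.white (G.nbr i)
  · rw [← H.tgt_black (G.bdry i) (G.nbr_notMem_range_bdry i) hw, G.rev_bdry_eq_nbr, h0, H.tgt_nbr]
  · rw [← H.tgt_white (G.bdry i) (G.nbr_notMem_range_bdry i) hw, G.rev_bdry_eq_nbr, h1, H.tgt_nbr]

/-- Soundness of the certificate. A dart of a trip with distinct ends has another trip on its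
reverse, so `lab_tgt` puts the target in the label on its left; crossing an edge off the trip
preserves membership by `lab_rev`. -/
theorem mem_lab_of_leftOfTrip (H : IsTripLabelling k G π tgt lab) {i : Fin n} (hi : π i ≠ i)
    {f : G.Face} (h : G.LeftOfTrip i f) : ∀ d, f = G.leftFace d → π i ∈ lab d := by
  -- Membership in the label descends to faces, which permits induction on the chain of crossings.
  let m : G.Face → Prop := Quot.lift (fun d => π i ∈ lab d) fun d e hde => by
    simp only [H.lab_faceStep d e hde]
  have hm : ∀ d, m (G.leftFace d) ↔ π i ∈ lab d := fun d => Iff.rfl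
  suffices m f by
    rintro d rfl
    exact this
  induction h with
  | adjacent d hd =>
    rw [H.onTrip_iff] at hd
    rw [hm, ← hd]
    refine (H.lab_tgt d fun h => hi ?_).1
    obtain ⟨j, hj, rfl | rfl⟩ := H.tgt_eq_tgt_rev d h
    · rw [H.tgt_bdry] at hd
      rwa [← π.injective hd]
    · rw [H.tgt_nbr] at hd
      rw [← hd, ← π.injective (hj.trans hd)]
  | cross d hd hd' _ ih =>
    rw [H.onTrip_iff] at hd hd'
    rw [hm] at ih ⊢
    rwa [← H.lab_rev d _ (Ne.symm hd) (Ne.symm hd')]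

theorem targetLabel_leftFace (H : IsTripLabelling k G π tgt lab) (d : G.Dart) :
    G.targetLabel (G.leftFace d) = lab d := by
  ext t
  constructor
  · rintro ⟨i, hi, ⟨hne, hl⟩ | ⟨rfl, hw⟩⟩
    · rw [H.tripEndsAt_iff] at hi
      subst hi
      exact H.mem_lab_of_leftOfTrip (Ne.symm hne) hl d rfl
    · rw [H.tripEndsAt_iff] at hi
      rwa [H.mem_lab_of_fixed i hi, ← H.white_of_fixed i hi]
  · intro ht
    by_cases hf : π t = t
    · refine ⟨t, (H.tripEndsAt_iff _ _).2 hf, Or.inr ⟨rfl, ?_⟩⟩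
      rwa [H.white_of_fixed t hf, ← H.mem_lab_of_fixed t hf d]
    · refine ⟨π.symm t, (H.tripEndsAt_iff _ _).2 (by simp), Or.inl ⟨?_, H.leftOfTrip d t ht hf⟩⟩
      intro h
      rw [Equiv.symm_apply_eq] at h
      exact hf h.symm

end IsTripLabelling

end PlabicGraph

namespace PlabicGraph

variable {n : ℕ}

/-! ### Subdividing the edge at a boundary vertex -/

section subdivide

variable (G : PlabicGraph n) (a : Fin n)

/-- The darts of `G`, as darts of the subdivided graph. -/
def subdivideOld (d : G.Dart) : (G.subdivide a).Dart := (Sum.inl d : G.Dart ⊕ Bool)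

/-- The darts leaving the new vertex of the subdivided graph. -/
def subdivideNew (e : Bool) : (G.subdivide a).Dart := (Sum.inr e : G.Dart ⊕ Bool)

theorem subdivideOld_injective : Function.Injective (G.subdivideOld a) := Sum.inl_injective

@[simp] theorem subdivideOld_inj {d e : G.Dart} :
    G.subdivideOld a d = G.subdivideOld a e ↔ d = e := (G.subdivideOld_injective a).eq_iff

/-- The involution reversing the darts of the subdivided graph. -/
def subdivideRev (d : G.Dart ⊕ Bool) : G.Dart ⊕ Bool :=
  Equiv.swap (Sum.inl (G.nbr a)) (Sum.inr true)
    (Equiv.Perm.sumCongr G.rev (Equiv.swap true false)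
      (Equiv.swap (Sum.inl (G.nbr a)) (Sum.inr true) d))

@[simp] theorem subdivide_bdry (i : Fin n) :
    (G.subdivide a).bdry i = (G.subdivideOld a (G.bdry i)) := rfl

@[simp] theorem subdivide_rot_inl (d : G.Dart) :
    (G.subdivide a).rot (G.subdivideOld a d) = (G.subdivideOld a (G.rot d)) := rfl

@[simp] theorem subdivide_rot_inr (e : Bool) :
    (G.subdivide a).rot (G.subdivideNew a e) = (G.subdivideNew a (!e)) := by
  cases e <;> rfl

@[simp] theorem subdivide_rot_symm_inl (d : G.Dart) :
    (G.subdivide a).rot.symm (G.subdivideOld a d) =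
      (G.subdivideOld a (G.rot.symm d)) := rfl

@[simp] theorem subdivide_rot_symm_inr (e : Bool) :
    (G.subdivide a).rot.symm (G.subdivideNew a e) = (G.subdivideNew a (!e)) := by
  cases e <;> rfl

@[simp] theorem subdivide_white_inl (d : G.Dart) :
    (G.subdivide a).white (G.subdivideOld a d) = G.white d := rfl

@[simp] theorem subdivide_white_inr (e : Bool) :
    (G.subdivide a).white (G.subdivideNew a e) = ! G.white (G.nbr a) := rfl

theorem subdivide_rev_inl {d : G.Dart} (h : d ≠ G.nbr a) (h' : d ≠ G.bdry a) :
    (G.subdivide a).rev (G.subdivideOld a d) = (G.subdivideOld a (G.rev d)) := by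
  have h1 : G.rev d ≠ G.nbr a := fun e => h' (G.rev.injective e)
  change G.subdivideRev a (Sum.inl d) = Sum.inl (G.rev d)
  simp [subdivideRev, Equiv.swap_apply_def, h, h1]

@[simp] theorem subdivide_rev_inl_nbr :
    (G.subdivide a).rev (G.subdivideOld a (G.nbr a)) =
      (G.subdivideNew a false) := by
  change G.subdivideRev a (Sum.inl (G.nbr a)) = Sum.inr false
  simp [subdivideRev, Equiv.swap_apply_def]

@[simp] theorem subdivide_rev_inl_bdry :
    (G.subdivide a).rev (G.subdivideOld a (G.bdry a)) =
      (G.subdivideNew a true) := by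
  change G.subdivideRev a (Sum.inl (G.bdry a)) = Sum.inr true
  simp [subdivideRev, Equiv.swap_apply_def, (G.nbr_ne_bdry a a).symm, rev_bdry_eq_nbr]

@[simp] theorem subdivide_rev_inr_true :
    (G.subdivide a).rev (G.subdivideNew a true) =
      (G.subdivideOld a (G.bdry a)) := by
  change G.subdivideRev a (Sum.inr true) = Sum.inl (G.bdry a)
  simp [subdivideRev, Equiv.swap_apply_def, (G.nbr_ne_bdry a a).symm, rev_nbr]

@[simp] theorem subdivide_rev_inr_false :
    (G.subdivide a).rev (G.subdivideNew a false) =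
      (G.subdivideOld a (G.nbr a)) := by
  change G.subdivideRev a (Sum.inr false) = Sum.inl (G.nbr a)
  simp [subdivideRev, Equiv.swap_apply_def]

@[simp] theorem subdivide_nbr_self :
    (G.subdivide a).nbr a = (G.subdivideNew a true) :=
  G.subdivide_rev_inl_bdry a

theorem subdivide_nbr_of_ne {i : Fin n} (h : i ≠ a) :
    (G.subdivide a).nbr i = (G.subdivideOld a (G.nbr i)) :=
  G.subdivide_rev_inl a (G.nbr_ne_bdry a i).symm fun e => h (G.bdry.injective e)

/-- The dart of `G` on the same side of the edge at `a` as a dart of the subdivided graph. -/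
def subdivideProj : (G.subdivide a).Dart → G.Dart :=
  Sum.elim id fun e => if e then G.nbr a else G.bdry a

@[simp] theorem subdivideProj_inl (d : G.Dart) :
    G.subdivideProj a (G.subdivideOld a d) = d := rfl

@[simp] theorem subdivideProj_inr_true :
    G.subdivideProj a (G.subdivideNew a true) = G.nbr a := rfl

@[simp] theorem subdivideProj_inr_false :
    G.subdivideProj a (G.subdivideNew a false) = G.bdry a := rfl

/-- Reversal is altered only at the two halves of the subdivided edge; these four darts are
separated from the rest. -/
theorem subdivide_cases {p : (G.subdivide a).Dart → Prop}
    (generic : ∀ d, d ≠ G.nbr a → d ≠ G.bdry a → p (G.subdivideOld a d))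
    (inl_nbr : p (G.subdivideOld a (G.nbr a)))
    (inl_bdry : p (G.subdivideOld a (G.bdry a)))
    (inr_true : p (G.subdivideNew a true))
    (inr_false : p (G.subdivideNew a false)) (d : (G.subdivide a).Dart) : p d := by
  rcases (d : G.Dart ⊕ Bool) with d | d
  · by_cases h : d = G.nbr a
    · subst h; exact inl_nbr
    · by_cases h' : d = G.bdry a
      · subst h'; exact inl_bdry
      · exact generic d h h'
  · cases d
    · exact inr_false
    · exact inr_true

theorem subdivideProj_rev (d : (G.subdivide a).Dart) :
    G.subdivideProj a ((G.subdivide a).rev d) = G.rev (G.subdivideProj a d) := by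
  induction d using subdivide_cases with
  | generic d h h' => simp [subdivide_rev_inl, h, h']
  | inl_nbr => simp [rev_nbr]
  | inl_bdry => simp [rev_bdry_eq_nbr]
  | inr_true => simp [rev_nbr]
  | inr_false => simp [rev_bdry_eq_nbr]

theorem subdivide_range_bdry (d : G.Dart) :
    (G.subdivideOld a d) ∈ Set.range (G.subdivide a).bdry ↔ d ∈ Set.range G.bdry := by
  constructor
  · rintro ⟨i, h⟩
    exact ⟨i, G.subdivideOld_injective a h⟩
  · rintro ⟨i, rfl⟩
    exact ⟨i, rfl⟩

theorem subdivide_inr_notMem_range_bdry (e : Bool) :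
    (G.subdivideNew a e) ∉ Set.range (G.subdivide a).bdry := by
  rintro ⟨i, h⟩
  cases h

theorem subdivide_isLollipop_of_ne {i : Fin n} (h : i ≠ a) (hi : G.IsLollipop i) :
    (G.subdivide a).IsLollipop i := by
  have hi' : G.rot (G.nbr i) = G.nbr i := hi
  change (G.subdivide a).rot ((G.subdivide a).nbr i) = (G.subdivide a).nbr i
  rw [subdivide_nbr_of_ne _ _ h, subdivide_rot_inl, hi']

theorem subdivide_leftFace_inr_true :
    (G.subdivide a).leftFace (G.subdivideNew a true) =
      (G.subdivide a).leftFace (G.subdivideOld a (G.nbr a)) := by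
  have h := FaceStep.internal (G := G.subdivide a) (G.subdivideOld a (G.nbr a))
    (by rw [subdivide_rev_inl_nbr]; exact G.subdivide_inr_notMem_range_bdry a _)
  rw [subdivide_rev_inl_nbr, subdivide_rot_symm_inr] at h
  exact (leftFace_eq_of_faceStep _ h).symm

theorem subdivide_leftFace_inr_false :
    (G.subdivide a).leftFace (G.subdivideNew a false) =
      (G.subdivide a).leftFace (G.subdivideOld a (G.bdry a)) := by
  have h := FaceStep.internal (G := G.subdivide a) (G.subdivideOld a (G.bdry a))
    (by rw [subdivide_rev_inl_bdry]; exact G.subdivide_inr_notMem_range_bdry a _)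
  rw [subdivide_rev_inl_bdry, subdivide_rot_symm_inr] at h
  exact (leftFace_eq_of_faceStep _ h).symm

theorem subdivide_leftFace_inl_subdivideProj (d : (G.subdivide a).Dart) :
    (G.subdivide a).leftFace (G.subdivideOld a (G.subdivideProj a d)) =
      (G.subdivide a).leftFace d := by
  induction d using subdivide_cases with
  | generic d h h' => rfl
  | inl_nbr => rfl
  | inl_bdry => rfl
  | inr_true => exact (G.subdivide_leftFace_inr_true a).symm
  | inr_false => exact (G.subdivide_leftFace_inr_false a).symm

/-- A face step along the subdivided edge becomes two steps with the same left face; all other steps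
survive unchanged. -/
theorem subdivide_leftFace_eq_of_faceStep {d e : G.Dart} (h : G.FaceStep d e) :
    (G.subdivide a).leftFace (G.subdivideOld a d) =
      (G.subdivide a).leftFace (G.subdivideOld a e) := by
  cases h with
  | internal _ h =>
    by_cases hb : d = G.bdry a
    · subst hb
      have h1 := FaceStep.internal (G := G.subdivide a) (G.subdivideNew a false)
        (by
          rw [subdivide_rev_inr_false, subdivide_range_bdry]
          exact G.nbr_notMem_range_bdry a)
      rw [subdivide_rev_inr_false, subdivide_rot_symm_inl] at h1
      rw [← subdivide_leftFace_inr_false]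
      exact leftFace_eq_of_faceStep _ h1
    · have hn : d ≠ G.nbr a := by
        rintro rfl
        exact h ⟨a, (G.rev_nbr a).symm⟩
      have h1 := FaceStep.internal (G := G.subdivide a) (G.subdivideOld a d)
        (by rwa [subdivide_rev_inl _ _ hn hb, subdivide_range_bdry])
      rw [subdivide_rev_inl _ _ hn hb, subdivide_rot_symm_inl] at h1
      exact leftFace_eq_of_faceStep _ h1
  | boundary i =>
    have h1 := FaceStep.boundary (G := G.subdivide a) i
    rw [subdivide_bdry] at h1
    by_cases hi : finRotate n i = a
    · rw [hi, subdivide_nbr_self] at h1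
      rw [hi, ← subdivide_leftFace_inr_true]
      exact leftFace_eq_of_faceStep _ h1
    · rw [subdivide_nbr_of_ne _ _ hi] at h1
      exact leftFace_eq_of_faceStep _ h1

/-- The face of the subdivided graph corresponding to a face of `G`. -/
def subdivideFace : G.Face → (G.subdivide a).Face :=
  Quot.lift (fun d => (G.subdivide a).leftFace (G.subdivideOld a d))
    fun _ _ h => G.subdivide_leftFace_eq_of_faceStep a h

theorem subdivideFace_leftFace (d : G.Dart) : G.subdivideFace a (G.leftFace d) =
    (G.subdivide a).leftFace (G.subdivideOld a d) := rfl

theorem leftFace_subdivide (d : (G.subdivide a).Dart) :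
    (G.subdivide a).leftFace d = G.subdivideFace a (G.leftFace (G.subdivideProj a d)) := by
  rw [subdivideFace_leftFace, subdivide_leftFace_inl_subdivideProj]

theorem subdivide_lab_eq_of_faceStep {α : Type*} {lab : G.Dart → α}
    (hl : ∀ d e, G.FaceStep d e → lab d = lab e) (d e : (G.subdivide a).Dart)
    (h : (G.subdivide a).FaceStep d e) :
    lab (G.subdivideProj a d) = lab (G.subdivideProj a e) := by
  cases h with
  | internal _ h =>
    induction d using subdivide_cases with
    | generic d h1 h2 =>
      rw [subdivide_rev_inl _ _ h1 h2] at h ⊢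
      rw [subdivide_range_bdry] at h
      exact hl _ _ (FaceStep.internal d h)
    | inl_nbr => simp
    | inl_bdry => simp
    | inr_true =>
      rw [subdivide_rev_inr_true] at h
      exact absurd ⟨a, rfl⟩ h
    | inr_false =>
      rw [subdivide_rev_inr_false] at h ⊢
      exact hl _ _ (FaceStep.internal (G.bdry a) (G.nbr_notMem_range_bdry a))
  | boundary i =>
    have h1 := hl _ _ (FaceStep.boundary i)
    by_cases hi : finRotate n i = a
    · rw [hi] at h1 ⊢
      rw [subdivide_nbr_self]
      exact h1
    · rw [subdivide_nbr_of_ne _ _ hi]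
      exact h1

/-- The last two conjuncts follow the trip onto the second half of the subdivided edge; without them
the induction could not resume beyond the new vertex. -/
theorem onTrip_subdivide {i : Fin n} {d : G.Dart} (h : G.OnTrip i d) :
    (G.subdivide a).OnTrip i (G.subdivideOld a d) ∧
      (d = G.nbr a → (G.subdivide a).OnTrip i (G.subdivideNew a true)) ∧
      (d = G.bdry a → (G.subdivide a).OnTrip i (G.subdivideNew a false)) := by
  -- At a vertex of degree two both rules of the road go straight on, so the colour is irrelevant.
  have key : ∀ d : (G.subdivide a).Dart, ∀ e : Bool, (G.subdivide a).OnTrip i d →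
      (G.subdivide a).rev d = (G.subdivideNew a e) →
      (G.subdivide a).OnTrip i (G.subdivideNew a (!e)) := by
    intro d e hd he
    cases hw : (G.subdivide a).white ((G.subdivide a).rev d)
    · have := OnTrip.right d hd (by rw [he]; exact G.subdivide_inr_notMem_range_bdry a e) hw
      rwa [he, subdivide_rot_inr] at this
    · have := OnTrip.left d hd (by rw [he]; exact G.subdivide_inr_notMem_range_bdry a e) hw
      rwa [he, subdivide_rot_symm_inr] at this
  have main : ∀ d : G.Dart, (G.subdivide a).OnTrip i (G.subdivideOld a d) →
      (G.subdivide a).OnTrip i (G.subdivideOld a d) ∧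
      (d = G.nbr a → (G.subdivide a).OnTrip i (G.subdivideNew a true)) ∧
      (d = G.bdry a → (G.subdivide a).OnTrip i (G.subdivideNew a false)) := by
    refine fun d hd => ⟨hd, ?_, ?_⟩
    · rintro rfl
      exact key _ false hd (G.subdivide_rev_inl_nbr a)
    · rintro rfl
      exact key _ true hd (G.subdivide_rev_inl_bdry a)
  have lift : ∀ d : G.Dart, G.rev d ∉ Set.range G.bdry →
      (G.subdivide a).OnTrip i (G.subdivideOld a d) ∧
      (d = G.nbr a → (G.subdivide a).OnTrip i (G.subdivideNew a true)) ∧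
      (d = G.bdry a → (G.subdivide a).OnTrip i (G.subdivideNew a false)) →
      ∃ e, (G.subdivide a).OnTrip i e ∧
        (G.subdivide a).rev e = (G.subdivideOld a (G.rev d)) := by
    intro d hr hd
    by_cases hb : d = G.bdry a
    · exact ⟨_, hd.2.2 hb, by rw [subdivide_rev_inr_false, hb, rev_bdry_eq_nbr]⟩
    · have hn : d ≠ G.nbr a := by
        rintro rfl
        exact hr ⟨a, (G.rev_nbr a).symm⟩
      exact ⟨_, hd.1, subdivide_rev_inl _ _ hn hb⟩
  induction h with
  | start => exact main _ OnTrip.start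
  | left d _ h hw ih =>
    obtain ⟨e, he, hr⟩ := lift d h ih
    have := OnTrip.left e he (by rwa [hr, subdivide_range_bdry]) (by rwa [hr])
    rw [hr] at this
    exact main _ this
  | right d _ h hb ih =>
    obtain ⟨e, he, hr⟩ := lift d h ih
    have := OnTrip.right e he (by rwa [hr, subdivide_range_bdry]) (by rwa [hr])
    rw [hr] at this
    exact main _ this

theorem onTrip_subdivide_of_proj {i : Fin n} (d : (G.subdivide a).Dart)
    (h : G.OnTrip i (G.subdivideProj a d)) : (G.subdivide a).OnTrip i d := by
  induction d using subdivide_cases with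
  | generic d _ _ => exact (G.onTrip_subdivide a h).1
  | inl_nbr => exact (G.onTrip_subdivide a h).1
  | inl_bdry => exact (G.onTrip_subdivide a h).1
  | inr_true => exact (G.onTrip_subdivide a h).2.1 rfl
  | inr_false => exact (G.onTrip_subdivide a h).2.2 rfl

variable {G a} {k : ℕ} {π : Equiv.Perm (Fin n)} {tgt : G.Dart → Fin n} {lab : G.Dart → Set (Fin n)}

theorem IsTripLabelling.tgt_subdivide (H : IsTripLabelling k G π tgt lab) {i : Fin n}
    {d : (G.subdivide a).Dart} (h : (G.subdivide a).OnTrip i d) :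
    tgt (G.subdivideProj a d) = π i := by
  induction h with
  | start => exact H.tgt_bdry i
  | left d _ h hw ih =>
    rw [← ih]
    clear ih
    induction d using subdivide_cases with
    | generic d h1 h2 =>
      rw [subdivide_rev_inl _ _ h1 h2] at h hw ⊢
      rw [subdivide_range_bdry] at h
      exact H.tgt_white d h hw
    | inl_nbr => simp
    | inl_bdry => simp
    | inr_true => exact absurd ⟨a, (G.subdivide_rev_inr_true a).symm⟩ h
    | inr_false =>
      rw [subdivide_rev_inr_false] at hw ⊢
      exact H.tgt_white (G.bdry a) (G.nbr_notMem_range_bdry a) hw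
  | right d _ h hb ih =>
    rw [← ih]
    clear ih
    induction d using subdivide_cases with
    | generic d h1 h2 =>
      rw [subdivide_rev_inl _ _ h1 h2] at h hb ⊢
      rw [subdivide_range_bdry] at h
      exact H.tgt_black d h hb
    | inl_nbr => simp
    | inl_bdry => simp
    | inr_true => exact absurd ⟨a, (G.subdivide_rev_inr_true a).symm⟩ h
    | inr_false =>
      rw [subdivide_rev_inr_false] at hb ⊢
      exact H.tgt_black (G.bdry a) (G.nbr_notMem_range_bdry a) hb

theorem IsTripLabelling.onTrip_subdivide_iff (H : IsTripLabelling k G π tgt lab) (i : Fin n)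
    (d : (G.subdivide a).Dart) :
    (G.subdivide a).OnTrip i d ↔ G.OnTrip i (G.subdivideProj a d) := by
  rw [H.onTrip_iff]
  exact ⟨H.tgt_subdivide, fun h => G.onTrip_subdivide_of_proj a d ((H.onTrip_iff _ _).2 h)⟩

theorem IsTripLabelling.leftOfTrip_subdivide (H : IsTripLabelling k G π tgt lab) {i : Fin n}
    {f : G.Face} (h : G.LeftOfTrip i f) : (G.subdivide a).LeftOfTrip i (G.subdivideFace a f) := by
  induction h with
  | adjacent d hd =>
    exact LeftOfTrip.adjacent (G := G.subdivide a) (G.subdivideOld a d)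
      ((H.onTrip_subdivide_iff _ _).2 hd)
  | cross d hd hd' _ ih =>
    have := LeftOfTrip.cross (G := G.subdivide a) (G.subdivideOld a d)
      (mt (H.onTrip_subdivide_iff _ _).1 hd)
      (by rwa [H.onTrip_subdivide_iff, subdivideProj_rev]) ih
    rwa [leftFace_subdivide, subdivideProj_rev] at this

/-- All data are pulled back along `subdivideProj`. A fixed point at a is excluded, since
subdividing its edge would destroy the lollipop that `lollipop_of_fixed` demands. -/
theorem IsTripLabelling.subdivide (H : IsTripLabelling k G π tgt lab) (ha : π a ≠ a) :
    IsTripLabelling k (G.subdivide a) π (tgt ∘ G.subdivideProj a) (lab ∘ G.subdivideProj a) where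
  tgt_bdry i := H.tgt_bdry i
  tgt_nbr i := by
    by_cases h : i = a
    · subst h
      simp [H.tgt_nbr]
    · rw [subdivide_nbr_of_ne _ _ h]
      exact H.tgt_nbr i
  tgt_white d h hw := by
    have h1 := (H.onTrip_subdivide_iff (π.symm (tgt (G.subdivideProj a d))) d).2 (H.onTrip _)
    rw [Function.comp_apply, H.tgt_subdivide (OnTrip.left d h1 h hw)]
    simp
  tgt_black d h hw := by
    have h1 := (H.onTrip_subdivide_iff (π.symm (tgt (G.subdivideProj a d))) d).2 (H.onTrip _)
    rw [Function.comp_apply, H.tgt_subdivide (OnTrip.right d h1 h hw)]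
    simp
  onTrip d := (H.onTrip_subdivide_iff _ _).2 (H.onTrip _)
  lab_faceStep := G.subdivide_lab_eq_of_faceStep a H.lab_faceStep
  lab_tgt d := by
    simp only [Function.comp_apply, subdivideProj_rev]
    exact H.lab_tgt _
  lab_rev d t := by
    simp only [Function.comp_apply, subdivideProj_rev]
    exact H.lab_rev _ t
  tgt_eq_tgt_rev d h := by
    simp only [Function.comp_apply, subdivideProj_rev] at h
    obtain ⟨i, hi, h1⟩ := H.tgt_eq_tgt_rev _ h
    have hia : i ≠ a := by
      rintro rfl
      exact ha hi
    refine ⟨i, hi, ?_⟩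
    rw [subdivide_nbr_of_ne _ _ hia, subdivide_bdry]
    induction d using subdivide_cases with
    | generic d _ _ => simpa using h1
    | inl_nbr => simpa using h1
    | inl_bdry => simpa using h1
    | inr_true =>
      rcases h1 with h1 | h1
      · exact absurd h1 (G.nbr_ne_bdry _ _)
      · exact absurd (G.nbr_injective h1).symm hia
    | inr_false =>
      rcases h1 with h1 | h1
      · exact absurd (G.bdry.injective h1).symm hia
      · exact absurd h1.symm (G.nbr_ne_bdry _ _)
  lollipop_of_fixed i hi := by
    have hia : i ≠ a := by
      rintro rfl
      exact ha hi
    exact G.subdivide_isLollipop_of_ne a hia (H.lollipop_of_fixed i hi)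
  white_of_fixed i hi := by
    have hia : i ≠ a := by
      rintro rfl
      exact ha hi
    rw [subdivide_nbr_of_ne _ _ hia]
    exact H.white_of_fixed i hi
  mem_lab_of_fixed i hi d := H.mem_lab_of_fixed i hi _
  leftOfTrip d t ht hf := by
    rw [leftFace_subdivide]
    exact H.leftOfTrip_subdivide (H.leftOfTrip _ t ht hf)
  connected P hP f g hf := by
    obtain ⟨d, rfl⟩ := Quot.exists_rep f
    obtain ⟨e, rfl⟩ := Quot.exists_rep g
    change P ((G.subdivide a).leftFace d) at hf
    change P ((G.subdivide a).leftFace e)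
    rw [leftFace_subdivide] at hf ⊢
    refine H.connected (fun f => P (G.subdivideFace a f)) (fun d hd => ?_) _ _ hf
    have := hP (G.subdivideOld a d) hd
    rwa [leftFace_subdivide, subdivideProj_rev] at this

end subdivide

end PlabicGraph

namespace PlabicGraph

variable {n : ℕ}

/-! ### Joining two adjacent boundary edges -/

section join

variable (G : PlabicGraph n) (a b : Fin n)

/-- The darts of `G`, as darts of the graph with a new edge. -/
def joinOld (d : G.Dart) : (G.join a b).Dart := (Sum.inl d : G.Dart ⊕ Bool)

/-- The darts of the new edge, leaving `a` (`true`) or `b` (`false`). -/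
def joinNew (e : Bool) : (G.join a b).Dart := (Sum.inr e : G.Dart ⊕ Bool)

theorem joinOld_injective : Function.Injective (G.joinOld a b) := Sum.inl_injective

@[simp] theorem joinOld_inj {d e : G.Dart} :
    G.joinOld a b d = G.joinOld a b e ↔ d = e := (G.joinOld_injective a b).eq_iff

@[simp] theorem join_bdry (i : Fin n) : (G.join a b).bdry i = G.joinOld a b (G.bdry i) := rfl

@[simp] theorem join_nbr (i : Fin n) : (G.join a b).nbr i = G.joinOld a b (G.nbr i) := rfl

@[simp] theorem join_rev_old (d : G.Dart) :
    (G.join a b).rev (G.joinOld a b d) = G.joinOld a b (G.rev d) := rfl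

@[simp] theorem join_rev_new (e : Bool) :
    (G.join a b).rev (G.joinNew a b e) = G.joinNew a b (!e) := by
  cases e <;> rfl

@[simp] theorem join_white_old (d : G.Dart) :
    (G.join a b).white (G.joinOld a b d) = G.white d := rfl

@[simp] theorem join_white_new_true :
    (G.join a b).white (G.joinNew a b true) = G.white (G.nbr a) := rfl

@[simp] theorem join_white_new_false :
    (G.join a b).white (G.joinNew a b false) = G.white (G.nbr b) := rfl

/-- The rotation of the graph with a new edge. -/
def joinRot (d : G.Dart ⊕ Bool) : G.Dart ⊕ Bool :=
  Equiv.swap (Sum.inr true) (Sum.inl (G.nbr a))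
    (Equiv.Perm.sumCongr G.rot 1 (Equiv.swap (Sum.inl (G.nbr b)) (Sum.inr false) d))

theorem join_rot_old {u : G.Dart} (h : u ≠ G.nbr b) (h' : G.rot u ≠ G.nbr a) :
    (G.join a b).rot (G.joinOld a b u) = G.joinOld a b (G.rot u) := by
  change G.joinRot a b (Sum.inl u) = Sum.inl (G.rot u)
  simp [joinRot, Equiv.swap_apply_def, h, h']

theorem join_rot_old_nbr :
    (G.join a b).rot (G.joinOld a b (G.nbr b)) = G.joinNew a b false := by
  change G.joinRot a b (Sum.inl (G.nbr b)) = Sum.inr false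
  simp [joinRot, Equiv.swap_apply_def]

theorem join_rot_new_false (h : G.rot (G.nbr b) ≠ G.nbr a) :
    (G.join a b).rot (G.joinNew a b false) = G.joinOld a b (G.rot (G.nbr b)) := by
  change G.joinRot a b (Sum.inr false) = Sum.inl (G.rot (G.nbr b))
  simp [joinRot, Equiv.swap_apply_def, h]

theorem join_rot_symm_old {u : G.Dart} (h : u ≠ G.nbr a) (h' : G.rot.symm u ≠ G.nbr b) :
    (G.join a b).rot.symm (G.joinOld a b u) = G.joinOld a b (G.rot.symm u) := by
  rw [Equiv.symm_apply_eq, join_rot_old _ _ _ h' (by simpa using h), Equiv.apply_symm_apply]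

theorem join_rot_symm_old_of_eq {u : G.Dart} (h : u ≠ G.nbr a) (h' : G.rot.symm u = G.nbr b) :
    (G.join a b).rot.symm (G.joinOld a b u) = G.joinNew a b false := by
  have hu : G.rot (G.nbr b) = u := by rw [← h', Equiv.apply_symm_apply]
  rw [Equiv.symm_apply_eq, join_rot_new_false _ _ _ (by rwa [hu]), hu]

theorem join_rot_symm_old_nbr :
    (G.join a b).rot.symm (G.joinOld a b (G.nbr a)) = G.joinNew a b true := by
  rw [Equiv.symm_apply_eq]
  change Sum.inl (G.nbr a) = G.joinRot a b (Sum.inr true)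
  simp [joinRot, Equiv.swap_apply_def]

theorem join_rot_symm_new_true (h : G.rot.symm (G.nbr a) ≠ G.nbr b) :
    (G.join a b).rot.symm (G.joinNew a b true) = G.joinOld a b (G.rot.symm (G.nbr a)) := by
  rw [Equiv.symm_apply_eq]
  change Sum.inr true = G.joinRot a b (Sum.inl (G.rot.symm (G.nbr a)))
  simp [joinRot, Equiv.swap_apply_def, h]

theorem join_rot_symm_new_false :
    (G.join a b).rot.symm (G.joinNew a b false) = G.joinOld a b (G.nbr b) := by
  rw [Equiv.symm_apply_eq, join_rot_old_nbr]

theorem join_range_bdry (d : G.Dart) :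
    G.joinOld a b d ∈ Set.range (G.join a b).bdry ↔ d ∈ Set.range G.bdry := by
  constructor
  · rintro ⟨i, h⟩
    exact ⟨i, G.joinOld_injective a b h⟩
  · rintro ⟨i, rfl⟩
    exact ⟨i, rfl⟩

theorem joinNew_notMem_range_bdry (e : Bool) :
    G.joinNew a b e ∉ Set.range (G.join a b).bdry := by
  rintro ⟨i, h⟩
  cases h

theorem join_isLollipop_of_ne {i : Fin n} (ha : i ≠ a) (hb : i ≠ b) (hi : G.IsLollipop i) :
    (G.join a b).IsLollipop i := by
  have hi' : G.rot (G.nbr i) = G.nbr i := hi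
  change (G.join a b).rot (G.joinOld a b (G.nbr i)) = G.joinOld a b (G.nbr i)
  have h1 : G.nbr i ≠ G.nbr b := G.nbr_injective.ne hb
  have h2 : G.nbr i ≠ G.nbr a := G.nbr_injective.ne ha
  rw [join_rot_old _ _ _ h1 (by rwa [hi']), hi']

variable {G a b}

/-- The new face lies to the left of `bdry a`, of the bridge dart leaving a, and of `nbr b`. These
are isolated together with the opposite bridge dart, behind which the old face remains. -/
theorem join_cases {p : (G.join a b).Dart → Prop}
    (generic : ∀ d, d ≠ G.bdry a → d ≠ G.nbr b → p (G.joinOld a b d))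
    (old_bdry : p (G.joinOld a b (G.bdry a)))
    (old_nbr : p (G.joinOld a b (G.nbr b)))
    (new_true : p (G.joinNew a b true))
    (new_false : p (G.joinNew a b false)) (d : (G.join a b).Dart) : p d := by
  rcases (d : G.Dart ⊕ Bool) with d | d
  · by_cases h : d = G.bdry a
    · subst h; exact old_bdry
    · by_cases h' : d = G.nbr b
      · subst h'; exact old_nbr
      · exact generic d h h'
  · cases d
    · exact new_false
    · exact new_true

/-- The conditions under which the internal vertices at the consecutive boundary vertices `a` and `b`
of a graph with trip permutation `π` will be joined. -/
structure IsBridgeable (G : PlabicGraph n) (π : Equiv.Perm (Fin n)) (a b : Fin n) : Prop where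
  finRotate_eq : finRotate n a = b
  ne : a ≠ b
  white_a : G.white (G.nbr a) = true
  white_b : G.white (G.nbr b) = false
  ne_b : π a ≠ b
  ne_a : π b ≠ a

/-- The targets of the trips after joining. -/
def joinTgt (a b : Fin n) (π : Equiv.Perm (Fin n)) (tgt : G.Dart → Fin n) :
    (G.join a b).Dart → Fin n :=
  Sum.elim (fun d => if d = G.bdry a then π b else if d = G.bdry b then π a else tgt d)
    fun e => if e then π b else π a

/-- The target label of the new face. -/
def newLabel (a b : Fin n) (π : Equiv.Perm (Fin n)) (lab : G.Dart → Set (Fin n)) : Set (Fin n) :=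
  {t | (t ∈ lab (G.bdry a) ∧ t ≠ π a) ∨ t = π b}

/-- The labels after joining. -/
def joinLab (a b : Fin n) (π : Equiv.Perm (Fin n)) (lab : G.Dart → Set (Fin n)) :
    (G.join a b).Dart → Set (Fin n) :=
  Sum.elim (fun d => if d = G.bdry a ∨ d = G.nbr b then newLabel a b π lab else lab d)
    fun e => if e then newLabel a b π lab else lab (G.bdry a)

/-- A dart of the joined graph to the left of which lies what is left of the face to the left of a
given dart of `G`. -/
def joinRep (G : PlabicGraph n) (a b : Fin n) (d : G.Dart) : (G.join a b).Dart :=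
  if d = G.bdry a ∨ d = G.nbr b then G.joinNew a b false else G.joinOld a b d

variable {k : ℕ} {π : Equiv.Perm (Fin n)} {tgt : G.Dart → Fin n} {lab : G.Dart → Set (Fin n)}

theorem joinTgt_old (d : G.Dart) : joinTgt a b π tgt (G.joinOld a b d) =
    if d = G.bdry a then π b else if d = G.bdry b then π a else tgt d := rfl

@[simp] theorem joinTgt_new_true : joinTgt a b π tgt (G.joinNew a b true) = π b := rfl

@[simp] theorem joinTgt_new_false : joinTgt a b π tgt (G.joinNew a b false) = π a := rfl

@[simp] theorem joinTgt_bdry_left : joinTgt a b π tgt (G.joinOld a b (G.bdry a)) = π b := by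
  simp [joinTgt_old]

@[simp] theorem joinTgt_bdry_right : joinTgt a b π tgt (G.joinOld a b (G.bdry b)) = π a := by
  by_cases h : b = a <;> simp [joinTgt_old, h]

theorem joinTgt_of_ne {d : G.Dart} (h : d ≠ G.bdry a) (h' : d ≠ G.bdry b) :
    joinTgt a b π tgt (G.joinOld a b d) = tgt d := by
  simp [joinTgt_old, h, h']

@[simp] theorem joinTgt_nbr (i : Fin n) :
    joinTgt a b π tgt (G.joinOld a b (G.nbr i)) = tgt (G.nbr i) :=
  joinTgt_of_ne (G.nbr_ne_bdry _ _) (G.nbr_ne_bdry _ _)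

@[simp] theorem joinLab_new_true :
    joinLab a b π lab (G.joinNew a b true) = newLabel a b π lab := rfl

@[simp] theorem joinLab_new_false :
    joinLab a b π lab (G.joinNew a b false) = lab (G.bdry a) := rfl

theorem joinLab_old (d : G.Dart) : joinLab a b π lab (G.joinOld a b d) =
    if d = G.bdry a ∨ d = G.nbr b then newLabel a b π lab else lab d := rfl

@[simp] theorem joinLab_bdry :
    joinLab a b π lab (G.joinOld a b (G.bdry a)) = newLabel a b π lab := by
  simp [joinLab_old]

@[simp] theorem joinLab_nbr :
    joinLab a b π lab (G.joinOld a b (G.nbr b)) = newLabel a b π lab := by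
  simp [joinLab_old]

theorem joinLab_of_ne {d : G.Dart} (h : d ≠ G.bdry a) (h' : d ≠ G.nbr b) :
    joinLab a b π lab (G.joinOld a b d) = lab d := by
  simp [joinLab_old, h, h']

@[simp] theorem joinRep_bdry : G.joinRep a b (G.bdry a) = G.joinNew a b false := by
  simp [joinRep]

@[simp] theorem joinRep_nbr : G.joinRep a b (G.nbr b) = G.joinNew a b false := by
  simp [joinRep]

theorem joinRep_of_ne {d : G.Dart} (h : d ≠ G.bdry a) (h' : d ≠ G.nbr b) :
    G.joinRep a b d = G.joinOld a b d := by
  simp [joinRep, h, h']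

namespace IsBridgeable


/-- The two ends of the bridge have different colours, hence are different vertices. -/
theorem rot_symm_nbr_ne (B : IsBridgeable G π a b) : G.rot.symm (G.nbr a) ≠ G.nbr b := by
  intro h
  have := G.white_rot_symm (G.nbr a)
  rw [h, B.white_a, B.white_b] at this
  cases this

theorem rot_nbr_ne (B : IsBridgeable G π a b) : G.rot (G.nbr b) ≠ G.nbr a := by
  intro h
  have := G.white_rot (G.nbr b)
  rw [h, B.white_a, B.white_b] at this
  cases this

theorem nbr_ne (B : IsBridgeable G π a b) : G.nbr a ≠ G.nbr b := G.nbr_injective.ne B.ne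

theorem bdry_ne (B : IsBridgeable G π a b) : G.bdry a ≠ G.bdry b := G.bdry.injective.ne B.ne

end IsBridgeable

end join

end PlabicGraph

namespace PlabicGraph

variable {n : ℕ}

section join

variable {G : PlabicGraph n} {a b : Fin n} {k : ℕ} {π : Equiv.Perm (Fin n)} {tgt : G.Dart → Fin n}
  {lab : G.Dart → Set (Fin n)}

/-! #### Trips after joining -/

namespace IsBridgeable

theorem perm_a : (π * Equiv.swap a b) a = π b := by simp

theorem perm_b : (π * Equiv.swap a b) b = π a := by simp

theorem perm_of_ne {i : Fin n} (ha : i ≠ a) (hb : i ≠ b) : (π * Equiv.swap a b) i = π i := by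
  simp [Equiv.swap_apply_of_ne_of_ne ha hb]

theorem onTrip_a (B : IsBridgeable G π a b) : (G.join a b).OnTrip a (G.joinNew a b true) := by
  have := OnTrip.left (G := G.join a b) (i := a) (G.joinOld a b (G.bdry a)) OnTrip.start
    (by rw [join_rev_old, join_range_bdry]; exact G.nbr_notMem_range_bdry a)
    (by rw [join_rev_old, join_white_old]; exact B.white_a)
  rwa [join_rev_old, rev_bdry_eq_nbr, join_rot_symm_old_nbr] at this

theorem onTrip_b (B : IsBridgeable G π a b) : (G.join a b).OnTrip b (G.joinNew a b false) := by
  have := OnTrip.right (G := G.join a b) (i := b) (G.joinOld a b (G.bdry b)) OnTrip.start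
    (by rw [join_rev_old, join_range_bdry]; exact G.nbr_notMem_range_bdry b)
    (by rw [join_rev_old, join_white_old]; exact B.white_b)
  rwa [join_rev_old, rev_bdry_eq_nbr, join_rot_old_nbr] at this

/-- Beyond the edges at a and b the trips run as before, but those from a and b have exchanged their
beginnings: each now reaches the other's old course over the bridge. -/
theorem onTrip_old (B : IsBridgeable G π a b) (H : IsTripTarget G π tgt) {i : Fin n} {d : G.Dart}
    (h : G.OnTrip i d) (ha : d ≠ G.bdry a) (hb : d ≠ G.bdry b) :
    (G.join a b).OnTrip (Equiv.swap a b i) (G.joinOld a b d) := by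
  induction h with
  | start =>
    have h1 : i ≠ a := fun h => ha (by rw [h])
    have h2 : i ≠ b := fun h => hb (by rw [h])
    rw [Equiv.swap_apply_of_ne_of_ne h1 h2]
    exact OnTrip.start (G := G.join a b)
  | left d hd h hw ih =>
    clear ha hb
    by_cases hda : d = G.bdry a
    · subst hda
      have hi : i = a := π.injective (by rw [← H.tgt_of_onTrip hd, H.tgt_bdry])
      subst hi
      -- The old trip left a along its edge; the new one starts at b, arrives over the bridge and
      -- turns left at the white vertex into the same dart.
      rw [Equiv.swap_apply_left]
      have := OnTrip.left (G := G.join i b) _ B.onTrip_b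
        (by rw [join_rev_new]; exact joinNew_notMem_range_bdry _ _ _ _)
        (by rw [join_rev_new]; exact B.white_a)
      rwa [join_rev_new, Bool.not_false, join_rot_symm_new_true _ _ _ B.rot_symm_nbr_ne] at this
    · by_cases hdb : d = G.bdry b
      · subst hdb
        rw [rev_bdry_eq_nbr, B.white_b] at hw
        cases hw
      · have := OnTrip.left (G := G.join a b) _ (ih hda hdb)
          (by rwa [join_rev_old, join_range_bdry]) (by rwa [join_rev_old, join_white_old])
        rwa [join_rev_old, join_rot_symm_old] at this
        · exact fun h1 => hda (G.rev.injective h1)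
        · intro h1
          rw [← white_rot_symm, h1, B.white_b] at hw
          cases hw
  | right d hd h hw ih =>
    clear ha hb
    by_cases hdb : d = G.bdry b
    · subst hdb
      have hi : i = b := π.injective (by rw [← H.tgt_of_onTrip hd, H.tgt_bdry])
      subst hi
      rw [Equiv.swap_apply_right]
      have := OnTrip.right (G := G.join a i) _ B.onTrip_a
        (by rw [join_rev_new]; exact joinNew_notMem_range_bdry _ _ _ _)
        (by rw [join_rev_new]; exact B.white_b)
      rwa [join_rev_new, Bool.not_true, join_rot_new_false _ _ _ B.rot_nbr_ne] at this
    · by_cases hda : d = G.bdry a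
      · subst hda
        rw [rev_bdry_eq_nbr, B.white_a] at hw
        cases hw
      · have := OnTrip.right (G := G.join a b) _ (ih hda hdb)
          (by rwa [join_rev_old, join_range_bdry]) (by rwa [join_rev_old, join_white_old])
        rwa [join_rev_old, join_rot_old] at this
        · exact fun h1 => hdb (G.rev.injective h1)
        · intro h1
          rw [← white_rot, h1, B.white_a] at hw
          cases hw

end IsBridgeable

theorem IsTripTarget.join_tgt_white (H : IsTripTarget G π tgt) (B : IsBridgeable G π a b)
    (d : (G.join a b).Dart) (h : (G.join a b).rev d ∉ Set.range (G.join a b).bdry)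
    (hw : (G.join a b).white ((G.join a b).rev d) = true) :
    joinTgt a b π tgt ((G.join a b).rot.symm ((G.join a b).rev d)) = joinTgt a b π tgt d := by
  induction d using join_cases with
  | generic d h1 h2 =>
    rw [join_rev_old] at h hw ⊢
    rw [join_range_bdry] at h
    rw [join_white_old] at hw
    have h3 : G.rev d ≠ G.nbr a := fun e => h1 (G.rev.injective e)
    have h4 : G.rot.symm (G.rev d) ≠ G.nbr b := by
      intro e
      rw [← white_rot_symm, e, B.white_b] at hw
      cases hw
    have h5 : d ≠ G.bdry b := by
      rintro rfl
      rw [rev_bdry_eq_nbr, B.white_b] at hw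
      cases hw
    have h6 : ∀ i, G.rot.symm (G.rev d) ≠ G.bdry i := fun i e =>
      h ((G.rot_symm_mem_range_bdry_iff _).1 ⟨i, e.symm⟩)
    rw [join_rot_symm_old _ _ _ h3 h4, joinTgt_of_ne (h6 a) (h6 b), joinTgt_of_ne h1 h5,
      H.tgt_white d h hw]
  | old_bdry =>
    rw [join_rev_old, rev_bdry_eq_nbr, join_rot_symm_old_nbr]
    simp
  | old_nbr => exact absurd ⟨b, by simp [rev_nbr]⟩ h
  | new_true =>
    rw [join_rev_new, Bool.not_true, join_white_new_false, B.white_b] at hw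
    cases hw
  | new_false =>
    have h6 : ∀ i, G.rot.symm (G.nbr a) ≠ G.bdry i := fun i e =>
      G.nbr_notMem_range_bdry a ((G.rot_symm_mem_range_bdry_iff _).1 ⟨i, e.symm⟩)
    rw [join_rev_new, Bool.not_false, join_rot_symm_new_true _ _ _ B.rot_symm_nbr_ne,
      joinTgt_of_ne (h6 a) (h6 b), joinTgt_new_false, ← H.tgt_bdry a]
    exact H.tgt_white _ (G.nbr_notMem_range_bdry a) B.white_a

theorem IsTripTarget.join_tgt_black (H : IsTripTarget G π tgt) (B : IsBridgeable G π a b)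
    (d : (G.join a b).Dart) (h : (G.join a b).rev d ∉ Set.range (G.join a b).bdry)
    (hw : (G.join a b).white ((G.join a b).rev d) = false) :
    joinTgt a b π tgt ((G.join a b).rot ((G.join a b).rev d)) = joinTgt a b π tgt d := by
  have generic : ∀ d, d ≠ G.bdry a → d ≠ G.bdry b → G.rev d ∉ Set.range G.bdry →
      G.white (G.rev d) = false →
      joinTgt a b π tgt ((G.join a b).rot (G.joinOld a b (G.rev d))) =
        joinTgt a b π tgt (G.joinOld a b d) := by
    intro d h1 h2 h hw
    have h3 : G.rev d ≠ G.nbr b := fun e => h2 (G.rev.injective e)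
    have h4 : G.rot (G.rev d) ≠ G.nbr a := by
      intro e
      rw [← white_rot, e, B.white_a] at hw
      cases hw
    have h6 : ∀ i, G.rot (G.rev d) ≠ G.bdry i := fun i e =>
      h ((G.rot_mem_range_bdry_iff _).1 ⟨i, e.symm⟩)
    rw [join_rot_old _ _ _ h3 h4, joinTgt_of_ne (h6 a) (h6 b), joinTgt_of_ne h1 h2,
      H.tgt_black d h hw]
  induction d using join_cases with
  | generic d h1 h2 =>
    rw [join_rev_old] at h hw ⊢
    rw [join_range_bdry] at h
    rw [join_white_old] at hw
    by_cases h5 : d = G.bdry b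
    · rw [h5, rev_bdry_eq_nbr, join_rot_old_nbr]
      simp
    · exact generic d h1 h5 h hw
  | old_bdry =>
    rw [join_rev_old, join_white_old, rev_bdry_eq_nbr, B.white_a] at hw
    cases hw
  | old_nbr => exact absurd ⟨b, by simp [rev_nbr]⟩ h
  | new_true =>
    have h6 : ∀ i, G.rot (G.nbr b) ≠ G.bdry i := fun i e =>
      G.nbr_notMem_range_bdry b ((G.rot_mem_range_bdry_iff _).1 ⟨i, e.symm⟩)
    rw [join_rev_new, Bool.not_true, join_rot_new_false _ _ _ B.rot_nbr_ne,
      joinTgt_of_ne (h6 a) (h6 b), joinTgt_new_true, ← H.tgt_bdry b]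
    exact H.tgt_black _ (G.nbr_notMem_range_bdry b) B.white_b
  | new_false =>
    rw [join_rev_new, Bool.not_false, join_white_new_true, B.white_a] at hw
    cases hw

theorem IsTripTarget.join (H : IsTripTarget G π tgt) (B : IsBridgeable G π a b) :
    IsTripTarget (G.join a b) (π * Equiv.swap a b) (joinTgt a b π tgt) where
  tgt_bdry i := by
    rw [join_bdry]
    by_cases ha : i = a
    · subst ha; simp
    · by_cases hb : i = b
      · subst hb; simp
      · rw [joinTgt_of_ne (G.bdry.injective.ne ha) (G.bdry.injective.ne hb), H.tgt_bdry,
          IsBridgeable.perm_of_ne ha hb]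
  tgt_nbr i := by rw [join_nbr, joinTgt_nbr, H.tgt_nbr]
  tgt_white := H.join_tgt_white B
  tgt_black := H.join_tgt_black B
  onTrip d := by
    have hs : ∀ t, (π * Equiv.swap a b).symm t = Equiv.swap a b (π.symm t) := fun t => by
      rw [Equiv.symm_apply_eq]; simp
    rw [hs]
    have old : ∀ d, d ≠ G.bdry a → d ≠ G.bdry b → (G.join a b).OnTrip
        (Equiv.swap a b (π.symm (tgt d))) (G.joinOld a b d) := fun d h1 h2 =>
      B.onTrip_old H (H.onTrip d) h1 h2
    induction d using join_cases with
    | generic d h1 h2 =>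
      by_cases h3 : d = G.bdry b
      · subst h3
        rw [joinTgt_bdry_right, Equiv.symm_apply_apply, Equiv.swap_apply_left]
        exact OnTrip.start (G := G.join a b)
      · rw [joinTgt_of_ne h1 h3]
        exact old d h1 h3
    | old_bdry =>
      rw [joinTgt_bdry_left, Equiv.symm_apply_apply, Equiv.swap_apply_right]
      exact OnTrip.start (G := G.join a b)
    | old_nbr =>
      rw [joinTgt_nbr]
      exact old _ (G.nbr_ne_bdry _ _) (G.nbr_ne_bdry _ _)
    | new_true =>
      rw [joinTgt_new_true, Equiv.symm_apply_apply, Equiv.swap_apply_right]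
      exact B.onTrip_a
    | new_false =>
      rw [joinTgt_new_false, Equiv.symm_apply_apply, Equiv.swap_apply_left]
      exact B.onTrip_b

/-! #### Faces after joining -/

namespace IsBridgeable

theorem leftFace_old_bdry (G : PlabicGraph n) (a b : Fin n) :
    (G.join a b).leftFace (G.joinOld a b (G.bdry a)) =
    (G.join a b).leftFace (G.joinNew a b true) := by
  have h := FaceStep.internal (G := G.join a b) (G.joinOld a b (G.bdry a))
    (by rw [join_rev_old, join_range_bdry]; exact G.nbr_notMem_range_bdry a)
  rw [join_rev_old, rev_bdry_eq_nbr, join_rot_symm_old_nbr] at h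
  exact leftFace_eq_of_faceStep _ h

theorem leftFace_old_nbr (G : PlabicGraph n) (a b : Fin n) :
    (G.join a b).leftFace (G.joinOld a b (G.nbr b)) =
    (G.join a b).leftFace (G.joinNew a b true) := by
  have h := FaceStep.internal (G := G.join a b) (G.joinNew a b true)
    (by rw [join_rev_new]; exact joinNew_notMem_range_bdry _ _ _ _)
  rw [join_rev_new, Bool.not_true, join_rot_symm_new_false] at h
  exact (leftFace_eq_of_faceStep _ h).symm

/-- Both `bdry a` and `nbr b` are represented by the far side of the bridge, since the near side
belongs to the new face. The boundary step between them becomes trivial, and a step into one of the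
split corners meets the bridge instead. -/
theorem joinRep_faceStep (B : IsBridgeable G π a b) {d e : G.Dart} (h : G.FaceStep d e) :
    (G.join a b).leftFace (G.joinRep a b d) = (G.join a b).leftFace (G.joinRep a b e) := by
  cases h with
  | internal _ h =>
    have h6 : ∀ i, G.rot.symm (G.rev d) ≠ G.bdry i := fun i e =>
      h ((G.rot_symm_mem_range_bdry_iff _).1 ⟨i, e.symm⟩)
    have hb : d ≠ G.nbr b := by
      rintro rfl
      exact h ⟨b, (G.rev_nbr b).symm⟩
    by_cases ha : d = G.bdry a
    · subst ha
      have h1 := FaceStep.internal (G := G.join a b) (G.joinNew a b false)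
        (by rw [join_rev_new]; exact joinNew_notMem_range_bdry _ _ _ _)
      rw [join_rev_new, Bool.not_false, join_rot_symm_new_true _ _ _ B.rot_symm_nbr_ne] at h1
      rw [joinRep_bdry, joinRep_of_ne (h6 a) B.rot_symm_nbr_ne]
      exact leftFace_eq_of_faceStep _ h1
    · have h1 := FaceStep.internal (G := G.join a b) (G.joinOld a b d)
        (by rwa [join_rev_old, join_range_bdry])
      have h3 : G.rev d ≠ G.nbr a := fun e => ha (G.rev.injective e)
      rw [joinRep_of_ne ha hb, leftFace_eq_of_faceStep _ h1, join_rev_old]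
      by_cases h4 : G.rot.symm (G.rev d) = G.nbr b
      · rw [h4, joinRep_nbr, join_rot_symm_old_of_eq _ _ _ h3 h4]
      · rw [joinRep_of_ne (h6 a) h4, join_rot_symm_old _ _ _ h3 h4]
  | boundary i =>
    by_cases hi : i = a
    · subst hi
      rw [B.finRotate_eq, joinRep_bdry, joinRep_nbr]
    · have h1 : finRotate n i ≠ b := by
        rw [← B.finRotate_eq]
        exact (finRotate n).injective.ne hi
      rw [joinRep_of_ne (G.nbr_ne_bdry _ _) (G.nbr_injective.ne h1),
        joinRep_of_ne (G.bdry.injective.ne hi) (G.nbr_ne_bdry _ _).symm]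
      exact leftFace_eq_of_faceStep _ (FaceStep.boundary (G := G.join a b) i)

/-- What is left of a face of `G` after joining. -/
def joinFace (B : IsBridgeable G π a b) : G.Face → (G.join a b).Face :=
  Quot.lift (fun d => (G.join a b).leftFace (G.joinRep a b d)) fun _ _ h => B.joinRep_faceStep h

theorem joinFace_leftFace (B : IsBridgeable G π a b) (d : G.Dart) :
    B.joinFace (G.leftFace d) = (G.join a b).leftFace (G.joinRep a b d) := rfl

theorem joinFace_of_ne (B : IsBridgeable G π a b) {d : G.Dart} (ha : d ≠ G.bdry a)
    (hb : d ≠ G.nbr b) :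
    B.joinFace (G.leftFace d) = (G.join a b).leftFace (G.joinOld a b d) := by
  rw [joinFace_leftFace, joinRep_of_ne ha hb]

theorem joinFace_bdry (B : IsBridgeable G π a b) :
    B.joinFace (G.leftFace (G.bdry a)) = (G.join a b).leftFace (G.joinNew a b false) := by
  rw [joinFace_leftFace, joinRep_bdry]

theorem joinFace_nbr (B : IsBridgeable G π a b) :
    B.joinFace (G.leftFace (G.nbr b)) = (G.join a b).leftFace (G.joinNew a b false) := by
  rw [joinFace_leftFace, joinRep_nbr]

theorem leftFace_bdry_eq (B : IsBridgeable G π a b) :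
    G.leftFace (G.bdry a) = G.leftFace (G.nbr b) := by
  have := FaceStep.boundary (G := G) a
  rw [B.finRotate_eq] at this
  exact (leftFace_eq_of_faceStep _ this).symm

/-- The arc starting at a is excluded because it passes to the new face; every other arc stays on
the surviving part of its old face. -/
theorem join_boundary_leftFace (B : IsBridgeable G π a b) {i j : Fin n} (hi : i ≠ a) (hj : j ≠ a)
    (h : G.leftFace (G.bdry i) = G.leftFace (G.bdry j)) :
    (G.join a b).leftFace ((G.join a b).bdry i) = (G.join a b).leftFace ((G.join a b).bdry j) := by
  have h1 := congrArg B.joinFace h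
  rwa [B.joinFace_of_ne (G.bdry.injective.ne hi) (G.nbr_ne_bdry _ _).symm,
    B.joinFace_of_ne (G.bdry.injective.ne hj) (G.nbr_ne_bdry _ _).symm] at h1

end IsBridgeable

end join

end PlabicGraph

namespace PlabicGraph

variable {n : ℕ}

section join

variable {G : PlabicGraph n} {a b : Fin n} {k : ℕ} {π : Equiv.Perm (Fin n)} {tgt : G.Dart → Fin n}
  {lab : G.Dart → Set (Fin n)}

/-! #### Labels after joining -/

namespace IsBridgeable

theorem perm_ne (B : IsBridgeable G π a b) : π a ≠ π b := π.injective.ne B.ne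

/-- By `ne_a` and `ne_b` the bridge creates no fixed points. -/
theorem fixed_of_fixed (B : IsBridgeable G π a b) {i : Fin n} (h : (π * Equiv.swap a b) i = i) :
    i ≠ a ∧ i ≠ b ∧ π i = i := by
  have ha : i ≠ a := by
    rintro rfl
    rw [perm_a] at h
    exact B.ne_a h
  have hb : i ≠ b := by
    rintro rfl
    rw [perm_b] at h
    exact B.ne_b h
  exact ⟨ha, hb, by rwa [perm_of_ne ha hb] at h⟩

theorem lab_nbr (B : IsBridgeable G π a b) (H : IsTripLabelling k G π tgt lab) :
    lab (G.nbr b) = lab (G.bdry a) := by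
  have := FaceStep.boundary (G := G) a
  rw [B.finRotate_eq] at this
  exact H.lab_faceStep _ _ this

/-- The arc face lies to the left of the first dart of the trip from a; if that trip is a fixed
point, the white colour puts it in all labels. Dually, π(b) is absent because the arc face lies to
the right of the trip from b, or b is a black fixed point. -/
theorem mem_lab (B : IsBridgeable G π a b) (H : IsTripLabelling k G π tgt lab) :
    π a ∈ lab (G.bdry a) := by
  by_cases h : π a = a
  · rw [h, H.mem_lab_of_fixed a h, ← H.white_of_fixed a h]
    exact B.white_a
  · have := (H.lab_tgt (G.bdry a) (by rwa [H.tgt_bdry, rev_bdry_eq_nbr, H.tgt_nbr])).1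
    rwa [H.tgt_bdry] at this

theorem not_lt_of_fixed (B : IsBridgeable G π a b) (H : IsTripLabelling k G π tgt lab)
    (h : π b = b) : ¬ (b : ℕ) < k := by
  rw [← H.white_of_fixed b h, B.white_b]
  exact Bool.false_ne_true

theorem notMem_lab (B : IsBridgeable G π a b) (H : IsTripLabelling k G π tgt lab) :
    π b ∉ lab (G.bdry a) := by
  by_cases h : π b = b
  · rw [h, H.mem_lab_of_fixed b h]
    exact B.not_lt_of_fixed H h
  · have := (H.lab_tgt (G.bdry b) (by rwa [H.tgt_bdry, rev_bdry_eq_nbr, H.tgt_nbr])).2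
    rwa [H.tgt_bdry, rev_bdry_eq_nbr, B.lab_nbr H] at this

theorem mem_newLabel (_B : IsBridgeable G π a b) {t : Fin n} (ha : t ≠ π a) (hb : t ≠ π b) :
    t ∈ newLabel a b π lab ↔ t ∈ lab (G.bdry a) := by
  simp [newLabel, ha, hb]

theorem notMem_newLabel (B : IsBridgeable G π a b) : π a ∉ newLabel a b π lab := by
  simp [newLabel, B.perm_ne]

theorem mem_newLabel_self (a b : Fin n) (π : Equiv.Perm (Fin n)) (lab : G.Dart → Set (Fin n)) :
    π b ∈ newLabel a b π lab := Or.inr rfl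

theorem joinLab_joinRep (B : IsBridgeable G π a b) (H : IsTripLabelling k G π tgt lab)
    (d : G.Dart) : joinLab a b π lab (G.joinRep a b d) = lab d := by
  by_cases ha : d = G.bdry a
  · rw [ha, joinRep_bdry, joinLab_new_false]
  · by_cases hb : d = G.nbr b
    · rw [hb, joinRep_nbr, joinLab_new_false, B.lab_nbr H]
    · rw [joinRep_of_ne ha hb, joinLab_of_ne ha hb]

theorem joinLab_bdry_of_ne {i : Fin n} (h : i ≠ a) :
    joinLab a b π lab ((G.join a b).bdry i) = lab (G.bdry i) := by
  rw [join_bdry, joinLab_of_ne (G.bdry.injective.ne h) (G.nbr_ne_bdry _ _).symm]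

/-- No old label is lost, because the old arc face survives behind the bridge. -/
theorem range_joinLab (B : IsBridgeable G π a b) (H : IsTripLabelling k G π tgt lab) :
    Set.range (joinLab a b π lab) = insert (newLabel a b π lab) (Set.range lab) := by
  apply Set.Subset.antisymm
  · rintro _ ⟨d, rfl⟩
    induction d using join_cases with
    | generic d ha hb => exact Or.inr ⟨d, (joinLab_of_ne ha hb).symm⟩
    | old_bdry => exact Or.inl joinLab_bdry
    | old_nbr => exact Or.inl joinLab_nbr
    | new_true => exact Or.inl joinLab_new_true
    | new_false => exact Or.inr ⟨_, joinLab_new_false.symm⟩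
  · rintro _ (rfl | ⟨d, rfl⟩)
    · exact ⟨_, joinLab_new_true⟩
    · exact ⟨_, B.joinLab_joinRep H d⟩

theorem joinLab_faceStep (B : IsBridgeable G π a b) (H : IsTripLabelling k G π tgt lab)
    (d e : (G.join a b).Dart) (h : (G.join a b).FaceStep d e) :
    joinLab a b π lab d = joinLab a b π lab e := by
  cases h with
  | internal _ h =>
    induction d using join_cases with
    | generic d ha hb =>
      rw [join_rev_old] at h ⊢
      rw [join_range_bdry] at h
      have h6 : ∀ i, G.rot.symm (G.rev d) ≠ G.bdry i := fun i e =>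
        h ((G.rot_symm_mem_range_bdry_iff _).1 ⟨i, e.symm⟩)
      have h3 : G.rev d ≠ G.nbr a := fun e => ha (G.rev.injective e)
      rw [joinLab_of_ne ha hb, H.lab_faceStep _ _ (FaceStep.internal d h)]
      by_cases h4 : G.rot.symm (G.rev d) = G.nbr b
      · rw [join_rot_symm_old_of_eq _ _ _ h3 h4, joinLab_new_false, h4, B.lab_nbr H]
      · rw [join_rot_symm_old _ _ _ h3 h4, joinLab_of_ne (h6 a) h4]
    | old_bdry => rw [join_rev_old, rev_bdry_eq_nbr, join_rot_symm_old_nbr, joinLab_bdry,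
        joinLab_new_true]
    | old_nbr => exact absurd ⟨b, by simp [rev_nbr]⟩ h
    | new_true => rw [join_rev_new, Bool.not_true, join_rot_symm_new_false, joinLab_nbr,
        joinLab_new_true]
    | new_false =>
      have h6 : G.rot.symm (G.nbr a) ≠ G.bdry a := fun e =>
        G.nbr_notMem_range_bdry a ((G.rot_symm_mem_range_bdry_iff _).1 ⟨a, e.symm⟩)
      rw [join_rev_new, Bool.not_false, join_rot_symm_new_true _ _ _ B.rot_symm_nbr_ne,
        joinLab_of_ne h6 B.rot_symm_nbr_ne, joinLab_new_false]
      exact H.lab_faceStep _ _ (FaceStep.internal (G.bdry a) (G.nbr_notMem_range_bdry a))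
  | boundary i =>
    by_cases hi : i = a
    · subst hi
      rw [B.finRotate_eq, join_nbr, joinLab_nbr, join_bdry, joinLab_bdry]
    · have h1 : finRotate n i ≠ b := by
        rw [← B.finRotate_eq]
        exact (finRotate n).injective.ne hi
      rw [joinLab_bdry_of_ne hi, join_nbr,
        joinLab_of_ne (G.nbr_ne_bdry _ _) (G.nbr_injective.ne h1)]
      exact H.lab_faceStep _ _ (FaceStep.boundary i)

/-- The trip ending at a leaves along `nbr a` with the new face on its right. The replacement of
π(a) by π(b) does not disturb this unless a is fixed, and then a itself is removed. -/
theorem lab_nbr_a (B : IsBridgeable G π a b) (H : IsTripLabelling k G π tgt lab) :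
    a ∈ lab (G.nbr a) ∧ a ∉ newLabel a b π lab := by
  by_cases h : π a = a
  · refine ⟨?_, ?_⟩
    · rw [H.mem_lab_of_fixed a h, ← H.white_of_fixed a h]
      exact B.white_a
    · have := B.notMem_newLabel (lab := lab)
      rwa [h] at this
  · have := H.lab_tgt (G.nbr a) (by rw [rev_nbr, H.tgt_bdry, H.tgt_nbr]; exact Ne.symm h)
    rw [H.tgt_nbr, rev_nbr] at this
    exact ⟨this.1, by rw [B.mem_newLabel (Ne.symm h) B.ne_a.symm]; exact this.2⟩

theorem lab_bdry_b (B : IsBridgeable G π a b) (H : IsTripLabelling k G π tgt lab) :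
    b ∈ newLabel a b π lab ∧ b ∉ lab (G.bdry b) := by
  by_cases h : π b = b
  · refine ⟨Or.inr h.symm, ?_⟩
    rw [H.mem_lab_of_fixed b h]
    exact B.not_lt_of_fixed H h
  · have := H.lab_tgt (G.nbr b) (by rw [rev_nbr, H.tgt_bdry, H.tgt_nbr]; exact Ne.symm h)
    rw [H.tgt_nbr, rev_nbr, B.lab_nbr H] at this
    exact ⟨by rw [B.mem_newLabel B.ne_b.symm (Ne.symm h)]; exact this.1, this.2⟩

theorem lab_edge_a (_B : IsBridgeable G π a b) (H : IsTripLabelling k G π tgt lab) {t : Fin n}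
    (ht : t ≠ a) (ht' : t ≠ π a) : t ∈ lab (G.nbr a) ↔ t ∈ lab (G.bdry a) := by
  have := H.lab_rev (G.nbr a) t (by rwa [H.tgt_nbr]) (by rwa [rev_nbr, H.tgt_bdry])
  rwa [rev_nbr] at this

theorem lab_edge_b (B : IsBridgeable G π a b) (H : IsTripLabelling k G π tgt lab) {t : Fin n}
    (ht : t ≠ b) (ht' : t ≠ π b) : t ∈ lab (G.bdry a) ↔ t ∈ lab (G.bdry b) := by
  have := H.lab_rev (G.nbr b) t (by rwa [H.tgt_nbr]) (by rwa [rev_nbr, H.tgt_bdry])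
  rwa [rev_nbr, B.lab_nbr H] at this

theorem newLabel_edge_a (B : IsBridgeable G π a b) (H : IsTripLabelling k G π tgt lab) {t : Fin n}
    (ht : t ≠ a) (ht' : t ≠ π b) : t ∈ newLabel a b π lab ↔ t ∈ lab (G.nbr a) := by
  by_cases h : t = π a
  · subst h
    have := (H.lab_tgt (G.bdry a) (by rwa [rev_bdry_eq_nbr, H.tgt_bdry, H.tgt_nbr])).2
    rw [H.tgt_bdry, rev_bdry_eq_nbr] at this
    simp only [this, B.notMem_newLabel]
  · rw [B.mem_newLabel h ht', B.lab_edge_a H ht h]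

theorem newLabel_edge_b (B : IsBridgeable G π a b) (H : IsTripLabelling k G π tgt lab) {t : Fin n}
    (ht : t ≠ b) (ht' : t ≠ π a) : t ∈ newLabel a b π lab ↔ t ∈ lab (G.bdry b) := by
  by_cases h : t = π b
  · subst h
    have := (H.lab_tgt (G.bdry b) (by rwa [rev_bdry_eq_nbr, H.tgt_bdry, H.tgt_nbr])).1
    rw [H.tgt_bdry] at this
    simp only [this, mem_newLabel_self]
  · rw [B.mem_newLabel ht' h, B.lab_edge_b H ht h]

theorem rev_ne_bdry {d : G.Dart} (h : d ≠ G.nbr a) : G.rev d ≠ G.bdry a := fun e =>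
  h (G.rev.injective (e.trans (G.rev_nbr a).symm))

theorem rev_ne_nbr {d : G.Dart} (h : d ≠ G.bdry b) : G.rev d ≠ G.nbr b := fun e =>
  h (G.rev.injective e)

theorem joinLab_tgt (B : IsBridgeable G π a b) (H : IsTripLabelling k G π tgt lab)
    (d : (G.join a b).Dart)
    (h : joinTgt a b π tgt d ≠ joinTgt a b π tgt ((G.join a b).rev d)) :
    joinTgt a b π tgt d ∈ joinLab a b π lab d ∧
      joinTgt a b π tgt d ∉ joinLab a b π lab ((G.join a b).rev d) := by
  induction d using join_cases with
  | generic d ha hb =>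
    rw [join_rev_old] at h ⊢
    by_cases ha' : d = G.nbr a
    · subst ha'
      rw [rev_nbr, joinTgt_nbr, joinLab_bdry, joinLab_of_ne ha hb, H.tgt_nbr]
      exact B.lab_nbr_a H
    · by_cases hb' : d = G.bdry b
      · subst hb'
        rw [rev_bdry_eq_nbr, joinTgt_bdry_right, joinLab_nbr, joinLab_of_ne ha hb,
          ← B.lab_edge_b H B.ne_b B.perm_ne]
        exact ⟨B.mem_lab H, B.notMem_newLabel⟩
      · have h1 := rev_ne_bdry ha'
        have h2 := rev_ne_bdry hb
        have h3 := rev_ne_nbr hb'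
        rw [joinTgt_of_ne ha hb', joinTgt_of_ne h1 h2] at h
        rw [joinTgt_of_ne ha hb', joinLab_of_ne ha hb, joinLab_of_ne h1 h3]
        exact H.lab_tgt d h
  | old_bdry =>
    rw [join_rev_old, rev_bdry_eq_nbr, joinTgt_bdry_left, joinLab_bdry,
      joinLab_of_ne (G.nbr_ne_bdry _ _) B.nbr_ne, B.lab_edge_a H B.ne_a B.perm_ne.symm]
    exact ⟨mem_newLabel_self _ _ _ _, B.notMem_lab H⟩
  | old_nbr =>
    rw [join_rev_old, rev_nbr, joinTgt_nbr, joinLab_nbr, H.tgt_nbr,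
      joinLab_of_ne B.bdry_ne.symm (G.nbr_ne_bdry _ _).symm]
    exact B.lab_bdry_b H
  | new_true => exact ⟨mem_newLabel_self _ _ _ _, B.notMem_lab H⟩
  | new_false => exact ⟨B.mem_lab H, B.notMem_newLabel⟩

theorem joinLab_rev (B : IsBridgeable G π a b) (H : IsTripLabelling k G π tgt lab)
    (d : (G.join a b).Dart) (t : Fin n) (h : t ≠ joinTgt a b π tgt d)
    (h' : t ≠ joinTgt a b π tgt ((G.join a b).rev d)) :
    t ∈ joinLab a b π lab d ↔ t ∈ joinLab a b π lab ((G.join a b).rev d) := by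
  induction d using join_cases with
  | generic d ha hb =>
    rw [join_rev_old] at h' ⊢
    by_cases ha' : d = G.nbr a
    · subst ha'
      rw [joinTgt_nbr, H.tgt_nbr] at h
      rw [rev_nbr, joinTgt_bdry_left] at h'
      rw [rev_nbr, joinLab_bdry, joinLab_of_ne ha hb, B.newLabel_edge_a H h h']
    · by_cases hb' : d = G.bdry b
      · subst hb'
        rw [rev_bdry_eq_nbr, joinTgt_nbr, H.tgt_nbr] at h'
        rw [joinTgt_bdry_right] at h
        rw [rev_bdry_eq_nbr, joinLab_nbr, joinLab_of_ne ha hb, B.newLabel_edge_b H h' h]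
      · have h1 := rev_ne_bdry ha'
        have h2 := rev_ne_bdry hb
        have h3 := rev_ne_nbr hb'
        rw [joinTgt_of_ne ha hb'] at h
        rw [joinTgt_of_ne h1 h2] at h'
        rw [joinLab_of_ne ha hb, joinLab_of_ne h1 h3]
        exact H.lab_rev d t h h'
  | old_bdry =>
    rw [joinTgt_bdry_left] at h
    rw [join_rev_old, rev_bdry_eq_nbr, joinTgt_nbr, H.tgt_nbr] at h'
    rw [join_rev_old, rev_bdry_eq_nbr, joinLab_bdry,
      joinLab_of_ne (G.nbr_ne_bdry _ _) B.nbr_ne, B.newLabel_edge_a H h' h]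
  | old_nbr =>
    rw [joinTgt_nbr, H.tgt_nbr] at h
    rw [join_rev_old, rev_nbr, joinTgt_bdry_right] at h'
    rw [join_rev_old, rev_nbr, joinLab_nbr,
      joinLab_of_ne B.bdry_ne.symm (G.nbr_ne_bdry _ _).symm, B.newLabel_edge_b H h h']
  | new_true =>
    rw [join_rev_new, Bool.not_true, joinTgt_new_false] at h'
    exact B.mem_newLabel h' h
  | new_false =>
    rw [join_rev_new, Bool.not_false, joinTgt_new_true] at h'
    exact (B.mem_newLabel h h').symm

theorem joinTgt_eq_rev (B : IsBridgeable G π a b) (H : IsTripLabelling k G π tgt lab)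
    (d : (G.join a b).Dart)
    (h : joinTgt a b π tgt d = joinTgt a b π tgt ((G.join a b).rev d)) :
    ∃ i, (π * Equiv.swap a b) i = i ∧ (d = (G.join a b).bdry i ∨ d = (G.join a b).nbr i) := by
  induction d using join_cases with
  | generic d ha hb =>
    rw [join_rev_old] at h
    by_cases ha' : d = G.nbr a
    · rw [ha', rev_nbr, joinTgt_nbr, H.tgt_nbr, joinTgt_bdry_left] at h
      exact absurd h.symm B.ne_a
    · by_cases hb' : d = G.bdry b
      · rw [hb', rev_bdry_eq_nbr, joinTgt_nbr, H.tgt_nbr, joinTgt_bdry_right] at h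
        exact absurd h B.ne_b
      · rw [joinTgt_of_ne ha hb', joinTgt_of_ne (rev_ne_bdry ha') (rev_ne_bdry hb)] at h
        obtain ⟨i, hi, h1⟩ := H.tgt_eq_tgt_rev d h
        have hia : i ≠ a := by
          rintro rfl
          exact h1.elim ha ha'
        have hib : i ≠ b := by
          rintro rfl
          exact h1.elim hb' hb
        refine ⟨i, by rwa [perm_of_ne hia hib], ?_⟩
        simpa using h1
  | old_bdry =>
    rw [join_rev_old, rev_bdry_eq_nbr, joinTgt_nbr, H.tgt_nbr, joinTgt_bdry_left] at h
    exact absurd h B.ne_a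
  | old_nbr =>
    rw [join_rev_old, rev_nbr, joinTgt_nbr, H.tgt_nbr, joinTgt_bdry_right] at h
    exact absurd h.symm B.ne_b
  | new_true => exact absurd h B.perm_ne.symm
  | new_false => exact absurd h B.perm_ne

theorem joinLab_of_fixed (B : IsBridgeable G π a b) (H : IsTripLabelling k G π tgt lab)
    {i : Fin n} (hi : (π * Equiv.swap a b) i = i) (d : (G.join a b).Dart) :
    i ∈ joinLab a b π lab d ↔ (i : ℕ) < k := by
  obtain ⟨ha, hb, hf⟩ := B.fixed_of_fixed hi
  have h1 : i ≠ π a := fun h => ha (π.injective (hf.trans h))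
  have h2 : i ≠ π b := fun h => hb (π.injective (hf.trans h))
  have h3 : i ∈ newLabel a b π lab ↔ (i : ℕ) < k := by
    rw [B.mem_newLabel h1 h2, H.mem_lab_of_fixed i hf]
  induction d using join_cases with
  | generic d ha hb => rw [joinLab_of_ne ha hb, H.mem_lab_of_fixed i hf]
  | old_bdry => rwa [joinLab_bdry]
  | old_nbr => rwa [joinLab_nbr]
  | new_true => rwa [joinLab_new_true]
  | new_false => rw [joinLab_new_false, H.mem_lab_of_fixed i hf]

/-- Up to crossing the bridge every face is a surviving old face, so connectedness is inherited;
crossing an old edge at a or b becomes crossing that edge and the bridge. -/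
theorem join_connected (B : IsBridgeable G π a b) (H : IsTripLabelling k G π tgt lab)
    (P : (G.join a b).Face → Prop)
    (hP : ∀ d, P ((G.join a b).leftFace d) → P ((G.join a b).leftFace ((G.join a b).rev d)))
    (f g : (G.join a b).Face) (hf : P f) : P g := by
  have h1 : P ((G.join a b).leftFace (G.joinNew a b true)) ↔
      P ((G.join a b).leftFace (G.joinNew a b false)) := ⟨hP _, hP _⟩
  have h2 : P ((G.join a b).leftFace (G.joinOld a b (G.bdry a))) ↔
      P ((G.join a b).leftFace (G.joinOld a b (G.nbr a))) :=
    ⟨hP _, fun h => by simpa only [join_rev_old, rev_nbr] using hP _ h⟩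
  have h3 : P ((G.join a b).leftFace (G.joinOld a b (G.bdry b))) ↔
      P ((G.join a b).leftFace (G.joinOld a b (G.nbr b))) :=
    ⟨hP _, fun h => by simpa only [join_rev_old, rev_nbr] using hP _ h⟩
  have toJoinFace : ∀ d : (G.join a b).Dart, ∃ e : G.Dart,
      (P ((G.join a b).leftFace d) ↔ P (B.joinFace (G.leftFace e))) := by
    intro d
    induction d using join_cases with
    | generic d ha hb => exact ⟨d, by rw [B.joinFace_of_ne ha hb]⟩
    | old_bdry => exact ⟨G.bdry a, by rw [B.joinFace_bdry, leftFace_old_bdry, h1]⟩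
    | old_nbr => exact ⟨G.bdry a, by rw [B.joinFace_bdry, leftFace_old_nbr, h1]⟩
    | new_true => exact ⟨G.bdry a, by rw [B.joinFace_bdry, h1]⟩
    | new_false => exact ⟨G.bdry a, by rw [B.joinFace_bdry]⟩
  obtain ⟨d, rfl⟩ := Quot.exists_rep f
  obtain ⟨e, rfl⟩ := Quot.exists_rep g
  change P ((G.join a b).leftFace d) at hf
  change P ((G.join a b).leftFace e)
  obtain ⟨d', hd⟩ := toJoinFace d
  obtain ⟨e', he⟩ := toJoinFace e
  rw [he]
  refine H.connected (fun f => P (B.joinFace f)) (fun d hd => ?_) _ _ (hd.1 hf)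
  rw [leftFace_old_bdry] at h2
  rw [leftFace_old_nbr] at h3
  by_cases h4 : d = G.bdry a
  · subst h4
    rw [B.joinFace_bdry] at hd
    rwa [rev_bdry_eq_nbr, B.joinFace_of_ne (G.nbr_ne_bdry _ _) B.nbr_ne, ← h2, h1]
  by_cases h5 : d = G.nbr b
  · subst h5
    rw [B.joinFace_nbr] at hd
    rwa [rev_nbr, B.joinFace_of_ne B.bdry_ne.symm (G.nbr_ne_bdry _ _).symm, h3, h1]
  by_cases h6 : d = G.nbr a
  · subst h6
    rw [B.joinFace_of_ne h4 h5] at hd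
    rwa [rev_nbr, B.joinFace_bdry, ← h1, h2]
  by_cases h7 : d = G.bdry b
  · subst h7
    rw [B.joinFace_of_ne h4 h5] at hd
    rwa [rev_bdry_eq_nbr, B.joinFace_nbr, ← h1, ← h3]
  rw [B.joinFace_of_ne h4 h5] at hd
  rw [B.joinFace_of_ne (rev_ne_bdry h6) (rev_ne_nbr h7)]
  exact hP _ hd

end IsBridgeable

end join

end PlabicGraph

/-! ### The left sides of trips after joining -/

namespace PlabicGraph

variable {n : ℕ}

section join

variable {G : PlabicGraph n} {a b : Fin n} {k : ℕ} {π : Equiv.Perm (Fin n)} {tgt : G.Dart → Fin n}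
  {lab : G.Dart → Set (Fin n)}

namespace IsBridgeable

/-- If the two darts of an edge do not belong to the trip from `i`, then one can cross this edge. -/
theorem cross_join (B : IsBridgeable G π a b) (H : IsTripTarget G π tgt) {i : Fin n}
    {d e : (G.join a b).Dart} (h : (G.join a b).LeftOfTrip i ((G.join a b).leftFace d))
    (he : (G.join a b).rev d = e) (hd : joinTgt a b π tgt d ≠ (π * Equiv.swap a b) i)
    (hd' : joinTgt a b π tgt e ≠ (π * Equiv.swap a b) i) :
    (G.join a b).LeftOfTrip i ((G.join a b).leftFace e) := by
  subst he
  have H' := H.join B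
  exact LeftOfTrip.cross d (by rwa [H'.onTrip_iff]) (by rwa [H'.onTrip_iff]) h

theorem adjacent_join (B : IsBridgeable G π a b) (H : IsTripTarget G π tgt) {i : Fin n}
    {d : (G.join a b).Dart} (hd : joinTgt a b π tgt d = (π * Equiv.swap a b) i) :
    (G.join a b).LeftOfTrip i ((G.join a b).leftFace d) :=
  LeftOfTrip.adjacent d (by rwa [(H.join B).onTrip_iff])

/-- A chain of crossings in the old graph is copied, with detours through the new face at the edges
of a and b. The bridge could block only the old trips from a and b. For the trip from a the face
sought is adjacent to the new trip anyway; for the trip from b the crossing at a cannot occur,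
because soundness would put π(b) in the label of the arc face. -/
theorem leftOfTrip_joinFace (B : IsBridgeable G π a b) (H : IsTripLabelling k G π tgt lab)
    {i : Fin n} (hi : π i ≠ i) {f : G.Face} (h : G.LeftOfTrip i f) :
    (G.join a b).LeftOfTrip (Equiv.swap a b i) (B.joinFace f) := by
  have hs : (π * Equiv.swap a b) (Equiv.swap a b i) = π i := by simp
  have T := H.toIsTripTarget
  have newTrue : i = b → (G.join a b).LeftOfTrip (Equiv.swap a b i)
      ((G.join a b).leftFace (G.joinNew a b true)) := fun h => by
    refine B.adjacent_join T ?_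
    rw [hs, h, joinTgt_new_true]
  have newFalse : i = a → (G.join a b).LeftOfTrip (Equiv.swap a b i)
      ((G.join a b).leftFace (G.joinNew a b false)) := fun h => by
    refine B.adjacent_join T ?_
    rw [hs, h, joinTgt_new_false]
  have hne : ∀ j, i ≠ j → π j ≠ π i := fun j h => π.injective.ne h.symm
  induction h with
  | adjacent d hd =>
    rw [H.onTrip_iff] at hd
    by_cases h4 : d = G.bdry a
    · subst h4
      rw [H.tgt_bdry] at hd
      rw [B.joinFace_bdry]
      exact newFalse (π.injective hd).symm
    by_cases h5 : d = G.nbr b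
    · subst h5
      rw [H.tgt_nbr] at hd
      rw [B.joinFace_nbr]
      have hib : i ≠ b := by
        rintro rfl
        exact hi hd.symm
      -- The last dart of a trip ending at b now borders the new face; the surviving old face lies
      -- one crossing of the bridge further.
      have h1 := B.adjacent_join T (i := Equiv.swap a b i) (d := G.joinOld a b (G.nbr b))
        (by rw [hs, joinTgt_nbr, H.tgt_nbr, hd])
      rw [leftFace_old_nbr] at h1
      refine B.cross_join T h1 (join_rev_new _ _ _ _) ?_ ?_
      · rw [hs, joinTgt_new_true]
        exact hne b hib
      · rw [hs, joinTgt_new_false, ← hd]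
        exact B.ne_b
    rw [B.joinFace_of_ne h4 h5]
    by_cases h7 : d = G.bdry b
    · subst h7
      rw [H.tgt_bdry] at hd
      have hib : i = b := (π.injective hd).symm
      have h1 := newTrue hib
      rw [← leftFace_old_nbr] at h1
      refine B.cross_join T h1 (by rw [join_rev_old, rev_nbr]) ?_ ?_
      · rw [hs, joinTgt_nbr, H.tgt_nbr, hib]
        rw [hib] at hi
        exact hi.symm
      · rw [hs, joinTgt_bdry_right, hib]
        exact B.perm_ne
    · exact B.adjacent_join T (by rw [hs, joinTgt_of_ne h4 h7, hd])
  | cross d hd hd' hl ih =>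
    rw [H.onTrip_iff] at hd hd'
    by_cases h4 : d = G.bdry a
    · subst h4
      rw [H.tgt_bdry] at hd
      rw [rev_bdry_eq_nbr, H.tgt_nbr] at hd'
      have hib : i ≠ b := by
        rintro rfl
        exact B.notMem_lab H (H.mem_lab_of_leftOfTrip hi hl _ rfl)
      rw [B.joinFace_bdry] at ih
      rw [rev_bdry_eq_nbr, B.joinFace_of_ne (G.nbr_ne_bdry _ _) B.nbr_ne]
      have h1 := B.cross_join T ih (join_rev_new _ _ _ _) (by rwa [hs, joinTgt_new_false])
        (by rw [hs, Bool.not_false, joinTgt_new_true]; exact hne b hib)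
      rw [Bool.not_false, ← leftFace_old_bdry] at h1
      refine B.cross_join T h1 (by rw [join_rev_old, rev_bdry_eq_nbr]) ?_ ?_
      · rw [hs, joinTgt_bdry_left]
        exact hne b hib
      · rwa [hs, joinTgt_nbr, H.tgt_nbr]
    by_cases h5 : d = G.nbr b
    · subst h5
      rw [H.tgt_nbr] at hd
      rw [rev_nbr, H.tgt_bdry] at hd'
      rw [B.joinFace_nbr] at ih
      rw [rev_nbr, B.joinFace_of_ne B.bdry_ne.symm (G.nbr_ne_bdry _ _).symm]
      by_cases hia : i = a
      · exact B.adjacent_join T (by rw [hs, joinTgt_bdry_right, hia])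
      have h1 := B.cross_join T ih (join_rev_new _ _ _ _)
        (by rw [hs, joinTgt_new_false]; exact hne a hia) (by rwa [hs, Bool.not_false])
      rw [Bool.not_false, ← leftFace_old_nbr] at h1
      refine B.cross_join T h1 (by rw [join_rev_old, rev_nbr]) ?_ ?_
      · rwa [hs, joinTgt_nbr, H.tgt_nbr]
      · rw [hs, joinTgt_bdry_right]
        exact hne a hia
    rw [B.joinFace_of_ne h4 h5] at ih
    by_cases h6 : d = G.nbr a
    · subst h6
      rw [H.tgt_nbr] at hd
      rw [rev_nbr, H.tgt_bdry] at hd'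
      have hib : i ≠ b := by
        rintro rfl
        have h1 := H.mem_lab_of_leftOfTrip hi hl _ rfl
        rw [B.lab_edge_a H (Ne.symm hd) (Ne.symm hd')] at h1
        exact B.notMem_lab H h1
      rw [rev_nbr, B.joinFace_bdry]
      have h1 := B.cross_join T ih (e := G.joinOld a b (G.bdry a)) (by rw [join_rev_old, rev_nbr])
        (by rwa [hs, joinTgt_nbr, H.tgt_nbr])
        (by rw [hs, joinTgt_bdry_left]; exact hne b hib)
      rw [leftFace_old_bdry] at h1
      exact B.cross_join T h1 (join_rev_new _ _ _ _)
        (by rw [hs, joinTgt_new_true]; exact hne b hib) (by rwa [hs])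
    by_cases h7 : d = G.bdry b
    · subst h7
      rw [H.tgt_bdry] at hd
      rw [rev_bdry_eq_nbr, H.tgt_nbr] at hd'
      rw [rev_bdry_eq_nbr, B.joinFace_nbr]
      by_cases hia : i = a
      · exact newFalse hia
      have h1 := B.cross_join T ih (e := G.joinOld a b (G.nbr b))
        (by rw [join_rev_old, rev_bdry_eq_nbr])
        (by rw [hs, joinTgt_bdry_right]; exact hne a hia)
        (by rwa [hs, joinTgt_nbr, H.tgt_nbr])
      rw [leftFace_old_nbr] at h1
      exact B.cross_join T h1 (join_rev_new _ _ _ _) (by rwa [hs, joinTgt_new_true])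
        (by rw [hs, joinTgt_new_false]; exact hne a hia)
    rw [B.joinFace_of_ne (rev_ne_bdry h6) (rev_ne_nbr h7)]
    refine B.cross_join T ih (join_rev_old _ _ _ _) ?_ ?_
    · rwa [hs, joinTgt_of_ne h4 h7]
    · rwa [hs, joinTgt_of_ne (rev_ne_bdry h6) fun h => h5 (G.rev.injective (by rw [h, rev_nbr]))]

/-- The trip from b to the former white lollipop a uses only the bridge and the edges at a and b. It
lies beside the surviving arc face and blocks no other old edge, so connectedness of the old faces
spreads its left side over all of them. -/
theorem leftOfTrip_joinFace_of_fixed (B : IsBridgeable G π a b)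
    (H : IsTripLabelling k G π tgt lab) (ha : π a = a) (f : G.Face) :
    (G.join a b).LeftOfTrip b (B.joinFace f) := by
  have T := H.toIsTripTarget
  have hb : (π * Equiv.swap a b) b = a := by rw [perm_b, ha]
  have h0 : (G.join a b).LeftOfTrip b (B.joinFace (G.leftFace (G.bdry a))) := by
    rw [B.joinFace_bdry]
    exact B.adjacent_join T (by rw [hb, joinTgt_new_false, ha])
  refine H.connected (fun f => (G.join a b).LeftOfTrip b (B.joinFace f)) (fun d hd => ?_) _ f h0
  by_cases h4 : d = G.bdry a
  · subst h4
    rw [rev_bdry_eq_nbr, B.joinFace_of_ne (G.nbr_ne_bdry _ _) B.nbr_ne]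
    exact B.adjacent_join T (by rw [hb, joinTgt_nbr, H.tgt_nbr])
  by_cases h5 : d = G.nbr b
  · subst h5
    rw [rev_nbr, B.joinFace_of_ne B.bdry_ne.symm (G.nbr_ne_bdry _ _).symm]
    exact B.adjacent_join T (by rw [hb, joinTgt_bdry_right, ha])
  by_cases h6 : d = G.nbr a
  · subst h6
    rwa [rev_nbr]
  by_cases h7 : d = G.bdry b
  · subst h7
    rwa [rev_bdry_eq_nbr, ← B.leftFace_bdry_eq]
  have h8 := rev_ne_bdry h6
  have h9 := rev_ne_nbr h7
  have h10 : G.rev d ≠ G.nbr a := rev_ne_nbr h4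
  have h11 : G.rev d ≠ G.bdry b := rev_ne_bdry h5
  have L := H.lollipop_of_fixed a ha
  rw [B.joinFace_of_ne h4 h5] at hd
  rw [B.joinFace_of_ne h8 h9]
  refine B.cross_join T hd (join_rev_old _ _ _ _) ?_ ?_
  · rw [hb, joinTgt_of_ne h4 h7]
    exact fun h => (T.eq_or_eq_of_isLollipop L ha h).elim h4 h6
  · rw [hb, joinTgt_of_ne h8 h11]
    exact fun h => (T.eq_or_eq_of_isLollipop L ha h).elim h8 h10

theorem leftOfTrip_join (B : IsBridgeable G π a b) (H : IsTripLabelling k G π tgt lab)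
    (d : (G.join a b).Dart) (t : Fin n) (ht : t ∈ joinLab a b π lab d) :
    (G.join a b).LeftOfTrip ((π * Equiv.swap a b).symm t) ((G.join a b).leftFace d) ∨
      (π * Equiv.swap a b) t = t := by
  rw [or_iff_not_imp_right]
  intro hf
  have T := H.toIsTripTarget
  have hs : (π * Equiv.swap a b).symm t = Equiv.swap a b (π.symm t) := by
    rw [Equiv.symm_apply_eq]; simp
  have hs' : (π * Equiv.swap a b) (Equiv.swap a b (π.symm t)) = t := by simp
  rw [hs]
  have old : ∀ e, t ∈ lab e →
      (G.join a b).LeftOfTrip (Equiv.swap a b (π.symm t)) (B.joinFace (G.leftFace e)) := by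
    intro e he
    by_cases hft : π t = t
    · by_cases hta : t = a
      · subst hta
        rw [(Equiv.symm_apply_eq π).2 hft.symm, Equiv.swap_apply_left]
        exact B.leftOfTrip_joinFace_of_fixed H hft _
      -- A fixed point at b is black, so b lies in no old label; any other fixed point remains
      -- fixed.
      · by_cases htb : t = b
        · subst htb
          rw [H.mem_lab_of_fixed t hft] at he
          exact absurd he (B.not_lt_of_fixed H hft)
        · exact absurd (by rwa [perm_of_ne hta htb]) hf
    · refine B.leftOfTrip_joinFace H ?_ (H.leftOfTrip e t he hft)
      rw [Equiv.apply_symm_apply]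
      intro h
      exact hft (by conv_lhs => rw [h, Equiv.apply_symm_apply])
  have new : t ∈ newLabel a b π lab → (G.join a b).LeftOfTrip (Equiv.swap a b (π.symm t))
      ((G.join a b).leftFace (G.joinNew a b true)) := by
    intro h
    by_cases htb : t = π b
    · exact B.adjacent_join T (by rw [hs', joinTgt_new_true, htb])
    · have hta : t ≠ π a := by
        rintro rfl
        exact B.notMem_newLabel h
      rw [B.mem_newLabel hta htb] at h
      have h1 := old _ h
      rw [B.joinFace_bdry] at h1
      exact B.cross_join T h1 (join_rev_new _ _ _ _)
        (by rw [hs', joinTgt_new_false]; exact hta.symm)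
        (by rw [hs', joinTgt_new_true]; exact Ne.symm htb)
  induction d using join_cases with
  | generic d ha hb =>
    rw [joinLab_of_ne ha hb] at ht
    have := old d ht
    rwa [B.joinFace_of_ne ha hb] at this
  | old_bdry =>
    rw [joinLab_bdry] at ht
    rw [leftFace_old_bdry]
    exact new ht
  | old_nbr =>
    rw [joinLab_nbr] at ht
    rw [leftFace_old_nbr]
    exact new ht
  | new_true => exact new ht
  | new_false =>
    have := old _ ht
    rwa [B.joinFace_bdry] at this

end IsBridgeable

theorem IsTripLabelling.join (H : IsTripLabelling k G π tgt lab) (B : IsBridgeable G π a b) :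
    IsTripLabelling k (G.join a b) (π * Equiv.swap a b) (joinTgt a b π tgt)
      (joinLab a b π lab) where
  toIsTripTarget := H.toIsTripTarget.join B
  lab_faceStep := B.joinLab_faceStep H
  lab_tgt := B.joinLab_tgt H
  lab_rev := B.joinLab_rev H
  tgt_eq_tgt_rev := B.joinTgt_eq_rev H
  lollipop_of_fixed i hi := by
    obtain ⟨ha, hb, hf⟩ := B.fixed_of_fixed hi
    exact G.join_isLollipop_of_ne a b ha hb (H.lollipop_of_fixed i hf)
  white_of_fixed i hi := H.white_of_fixed i (B.fixed_of_fixed hi).2.2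
  mem_lab_of_fixed i hi d := B.joinLab_of_fixed H hi d
  leftOfTrip d t ht hf := (B.leftOfTrip_join H d t ht).resolve_right hf
  connected := B.join_connected H

end join

/-! ### Adding a bridge -/

section addBridge

variable {G : PlabicGraph n} {a b : Fin n} {k : ℕ} {π : Equiv.Perm (Fin n)} {tgt : G.Dart → Fin n}
  {lab : G.Dart → Set (Fin n)}

theorem subdivide_boundary_leftFace (G : PlabicGraph n) (a : Fin n) {i j : Fin n}
    (h : G.leftFace (G.bdry i) = G.leftFace (G.bdry j)) :
    (G.subdivide a).leftFace ((G.subdivide a).bdry i) =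
      (G.subdivide a).leftFace ((G.subdivide a).bdry j) :=
  congrArg (G.subdivideFace a) h

theorem range_subdivideProj (G : PlabicGraph n) (a : Fin n) :
    Set.range (G.subdivideProj a) = Set.univ :=
  Set.range_eq_univ.2 fun d => ⟨G.subdivideOld a d, rfl⟩

/-- One or two subdivisions produce the required colour, and a lollipop has it by hypothesis. What
later steps need is that colours at other vertices, labels at arcs and coincidences of boundary
faces survive. -/
theorem IsTripLabelling.prepareBridge (H : IsTripLabelling k G π tgt lab) (a : Fin n) (c : Bool)
    (hc : G.IsLollipop a → G.white (G.nbr a) = c) :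
    ∃ tgt' lab', IsTripLabelling k (G.prepareBridge a c) π tgt' lab' ∧
      (G.prepareBridge a c).white ((G.prepareBridge a c).nbr a) = c ∧
      (∀ i, i ≠ a → (G.prepareBridge a c).white ((G.prepareBridge a c).nbr i) =
        G.white (G.nbr i)) ∧
      (∀ i, lab' ((G.prepareBridge a c).bdry i) = lab (G.bdry i)) ∧
      Set.range lab' = Set.range lab ∧
      ∀ i j, G.leftFace (G.bdry i) = G.leftFace (G.bdry j) →
        (G.prepareBridge a c).leftFace ((G.prepareBridge a c).bdry i) =
          (G.prepareBridge a c).leftFace ((G.prepareBridge a c).bdry j) := by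
  have hr : ∀ (G : PlabicGraph n) (lab : G.Dart → Set (Fin n)),
      Set.range (lab ∘ G.subdivideProj a) = Set.range lab := fun G lab => by
    rw [Set.range_comp, range_subdivideProj, Set.image_univ]
  by_cases h1 : G.IsLollipop a
  · have e : G.prepareBridge a c = G := if_pos h1
    rw [e]
    exact ⟨tgt, lab, H, hc h1, fun _ _ => rfl, fun _ => rfl, rfl, fun _ _ h => h⟩
  have ha : π a ≠ a := fun h => h1 (H.lollipop_of_fixed a h)
  by_cases h2 : G.white (G.nbr a) = c
  · have e : G.prepareBridge a c = (G.subdivide a).subdivide a := (if_neg h1).trans (if_pos h2)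
    rw [e]
    refine ⟨_, _, (H.subdivide ha).subdivide ha, ?_, ?_, fun _ => rfl, ?_, ?_⟩
    · rw [subdivide_nbr_self, subdivide_white_inr, subdivide_nbr_self, subdivide_white_inr, h2,
        Bool.not_not]
    · intro i hi
      rw [subdivide_nbr_of_ne _ _ hi, subdivide_white_inl, subdivide_nbr_of_ne _ _ hi,
        subdivide_white_inl]
    · rw [hr, hr]
    · intro i j h
      exact subdivide_boundary_leftFace _ _ (subdivide_boundary_leftFace _ _ h)
  · have e : G.prepareBridge a c = G.subdivide a := (if_neg h1).trans (if_neg h2)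
    rw [e]
    refine ⟨_, _, H.subdivide ha, ?_, ?_, fun _ => rfl, hr _ _, ?_⟩
    · rw [subdivide_nbr_self, subdivide_white_inr]
      cases hw : G.white (G.nbr a) <;> cases c <;> simp_all
    · intro i hi
      rw [subdivide_nbr_of_ne _ _ hi, subdivide_white_inl]
    · intro i j h
      exact subdivide_boundary_leftFace _ _ h

theorem prepareBridge_isLollipop_of_ne {i : Fin n} (hi : i ≠ a) (c : Bool)
    (h : (G.prepareBridge a c).IsLollipop i) : G.IsLollipop i := by
  have sub : ∀ G : PlabicGraph n, (G.subdivide a).IsLollipop i → G.IsLollipop i := by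
    intro G h
    have h' : (G.subdivide a).rot ((G.subdivide a).nbr i) = (G.subdivide a).nbr i := h
    rw [subdivide_nbr_of_ne _ _ hi, subdivide_rot_inl, subdivideOld_inj] at h'
    exact h'
  rw [PlabicGraph.prepareBridge] at h
  split_ifs at h with h1 h2
  · exact h
  · exact sub _ (sub _ h)
  · exact sub _ h

theorem IsTripLabelling.addBridge (H : IsTripLabelling k G π tgt lab) (hab : finRotate n a = b)
    (hne : a ≠ b) (ha : π a ≠ b) (hb : π b ≠ a)
    (hwa : G.IsLollipop a → G.white (G.nbr a) = true)
    (hwb : G.IsLollipop b → G.white (G.nbr b) = false) :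
    ∃ tgt' lab', IsTripLabelling k (G.addBridge a b) (π * Equiv.swap a b) tgt' lab' ∧
      (∀ i, i ≠ a → lab' ((G.addBridge a b).bdry i) = lab (G.bdry i)) ∧
      lab' ((G.addBridge a b).bdry a) = newLabel a b π lab ∧
      Set.range lab' = insert (newLabel a b π lab) (Set.range lab) ∧
      ∀ i j, i ≠ a → j ≠ a → G.leftFace (G.bdry i) = G.leftFace (G.bdry j) →
        (G.addBridge a b).leftFace ((G.addBridge a b).bdry i) =
          (G.addBridge a b).leftFace ((G.addBridge a b).bdry j) := by
  obtain ⟨tgt1, lab1, H1, w1, v1, l1, r1, f1⟩ := H.prepareBridge a true hwa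
  obtain ⟨tgt2, lab2, H2, w2, v2, l2, r2, f2⟩ := H1.prepareBridge b false (by
    intro h
    rw [v1 b hne.symm]
    exact hwb (prepareBridge_isLollipop_of_ne hne.symm true h))
  have B : IsBridgeable ((G.prepareBridge a true).prepareBridge b false) π a b :=
    { finRotate_eq := hab
      ne := hne
      white_a := (v2 a hne).trans w1
      white_b := w2
      ne_b := ha
      ne_a := hb }
  have hN : newLabel a b π lab2 = newLabel a b π lab := by
    simp only [newLabel, l2, l1]
  refine ⟨_, _, H2.join B, ?_, ?_, ?_, ?_⟩
  · intro i hi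
    exact (IsBridgeable.joinLab_bdry_of_ne hi).trans ((l2 i).trans (l1 i))
  · exact joinLab_bdry.trans hN
  · exact (B.range_joinLab H2).trans (by rw [hN, r2, r1])
  · intro i j hi hj h
    exact B.join_boundary_leftFace hi hj (f2 _ _ (f1 _ _ h))

end addBridge

end PlabicGraph

namespace PlabicGraph

variable {n : ℕ}

/-! ### The lollipop graph -/

section lollipop

variable (n k : ℕ)

/-- A leaf does not separate the disk: both sides of its edge are one face, and the boundary steps
link consecutive lollipops. -/
theorem lollipopGraph_leftFace_eq (i j : Fin n) (e e' : Bool) :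
    (lollipopGraph n k).leftFace ((i, e) : Fin n × Bool) =
      (lollipopGraph n k).leftFace ((j, e') : Fin n × Bool) := by
  have h1 : ∀ i : Fin n, (lollipopGraph n k).leftFace ((i, true) : Fin n × Bool) =
      (lollipopGraph n k).leftFace ((i, false) : Fin n × Bool) := fun i =>
    leftFace_eq_of_faceStep _ (FaceStep.internal (G := lollipopGraph n k)
      ((i, true) : Fin n × Bool) ((lollipopGraph n k).nbr_notMem_range_bdry i))
  have h2 : ∀ i : Fin n, (lollipopGraph n k).leftFace ((finRotate n i, false) : Fin n × Bool) =
      (lollipopGraph n k).leftFace ((i, true) : Fin n × Bool) := fun i =>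
    leftFace_eq_of_faceStep _ (FaceStep.boundary (G := lollipopGraph n k) i)
  have h3 : ∀ i j : Fin n, (lollipopGraph n k).leftFace ((i, false) : Fin n × Bool) =
      (lollipopGraph n k).leftFace ((j, false) : Fin n × Bool) := by
    cases n with
    | zero => exact fun i => i.elim0
    | succ m =>
      have h4 : ∀ i : Fin (m + 1), (lollipopGraph (m + 1) k).leftFace
          ((i, false) : Fin (m + 1) × Bool) = (lollipopGraph (m + 1) k).leftFace
          (((0 : Fin (m + 1)), false) : Fin (m + 1) × Bool) := by
        intro i
        induction i using Fin.induction with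
        | zero => rfl
        | succ i ih =>
          have h5 : finRotate (m + 1) i.castSucc = i.succ := by
            rw [finRotate_apply, Fin.coeSucc_eq_succ]
          rw [← h5, h2, h1, ih]
      exact fun i j => (h4 i).trans (h4 j).symm
  have h4 : ∀ (i : Fin n) (e : Bool), (lollipopGraph n k).leftFace ((i, e) : Fin n × Bool) =
      (lollipopGraph n k).leftFace ((i, false) : Fin n × Bool) := by
    intro i e
    cases e
    · rfl
    · exact h1 i
  rw [h4 i, h4 j, h3 i j]

theorem lollipopGraph_isTripLabelling :
    IsTripLabelling k (lollipopGraph n k) 1 (fun d => d.1)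
      (fun _ => (initialSegment n k : Set (Fin n))) where
  tgt_bdry _ := rfl
  tgt_nbr _ := rfl
  tgt_white _ _ _ := rfl
  tgt_black _ _ _ := rfl
  onTrip := by
    rintro ⟨i, e⟩
    have h0 : (lollipopGraph n k).OnTrip i ((lollipopGraph n k).bdry i) := OnTrip.start
    have h : (lollipopGraph n k).OnTrip i ((i, false) : Fin n × Bool) := by
      cases hw : (lollipopGraph n k).white ((lollipopGraph n k).nbr i)
      · exact OnTrip.right _ h0 ((lollipopGraph n k).nbr_notMem_range_bdry i) hw
      · exact OnTrip.left _ h0 ((lollipopGraph n k).nbr_notMem_range_bdry i) hw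
    cases e
    · exact h
    · exact h0
  lab_faceStep _ _ _ := rfl
  lab_tgt _ h := absurd rfl h
  lab_rev _ _ _ _ := Iff.rfl
  tgt_eq_tgt_rev := by
    rintro ⟨i, e⟩ -
    refine ⟨i, rfl, ?_⟩
    cases e
    · exact Or.inr rfl
    · exact Or.inl rfl
  lollipop_of_fixed _ _ := rfl
  white_of_fixed i _ := by
    change decide ((i : ℕ) < k) = true ↔ _
    simp
  mem_lab_of_fixed i _ _ := by simp [initialSegment]
  leftOfTrip _ _ _ h := absurd rfl h
  connected P _ f g hf := by
    obtain ⟨⟨i, e⟩, rfl⟩ := Quot.exists_rep f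
    obtain ⟨⟨j, e'⟩, rfl⟩ := Quot.exists_rep g
    have := lollipopGraph_leftFace_eq n k i j e e'
    change P ((lollipopGraph n k).leftFace ((i, e) : Fin n × Bool)) at hf
    rwa [this] at hf

end lollipop

end PlabicGraph

/-! ### Rectangles -/

/-- The vertical steps of the rectangle with `p` rows and `q` columns. -/
def rectLabel (n k p q : ℕ) : Set (Fin n) :=
  {i | (i : ℕ) + p < k ∨ (k + q ≤ i + p ∧ (i : ℕ) < k + q)}

theorem mem_rectLabel {n k p q : ℕ} {i : Fin n} :
    i ∈ rectLabel n k p q ↔ (i : ℕ) + p < k ∨ (k + q ≤ i + p ∧ (i : ℕ) < k + q) := Iff.rfl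

theorem rectLabel_of_eq_zero {n k p q : ℕ} (h : p = 0 ∨ q = 0) :
    rectLabel n k p q = (initialSegment n k : Set (Fin n)) := by
  ext i
  simp only [mem_rectLabel, initialSegment, Finset.coe_filter, Finset.mem_univ, true_and,
    Set.mem_ofPred_eq]
  omega

theorem rectLabel_ne_initialSegment {n k p q : ℕ} (hp : 0 < p) (hq : 0 < q)
    (hn : k + q ≤ n) : rectLabel n k p q ≠ (initialSegment n k : Set (Fin n)) := by
  intro h
  have h1 : (⟨k + q - 1, by omega⟩ : Fin n) ∈ rectLabel n k p q := by
    rw [mem_rectLabel]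
    dsimp only
    omega
  rw [h] at h1
  simp only [initialSegment, Finset.coe_filter, Finset.mem_univ, true_and,
    Set.mem_ofPred_eq] at h1
  omega

/-- The largest element k + q - 1 and the first gap k - p of the label recover the two side lengths.
-/
theorem le_of_rectLabel_eq {n k p q p' q' : ℕ} (h : rectLabel n k p q = rectLabel n k p' q')
    (hp : 0 < p) (hq : 0 < q) (hpk : p ≤ k) (hn : k + q ≤ n) (hq' : 0 < q') : q ≤ q' ∧ p ≤ p' := by
  have h1 : (⟨k + q - 1, by omega⟩ : Fin n) ∈ rectLabel n k p q := by
    rw [mem_rectLabel]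
    dsimp only
    omega
  have h2 : (⟨k - p, by omega⟩ : Fin n) ∉ rectLabel n k p q := by
    rw [mem_rectLabel]
    dsimp only
    omega
  rw [h, mem_rectLabel] at h1 h2
  dsimp only at h1 h2
  omega

theorem rectLabel_injective {n k p q p' q' : ℕ} (h : rectLabel n k p q = rectLabel n k p' q')
    (hp : 0 < p) (hq : 0 < q) (hpk : p ≤ k) (hn : k + q ≤ n) (hp' : 0 < p') (hq' : 0 < q')
    (hpk' : p' ≤ k) (hn' : k + q' ≤ n) : p = p' ∧ q = q' := by
  have h1 := le_of_rectLabel_eq h hp hq hpk hn hq'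
  have h2 := le_of_rectLabel_eq h.symm hp' hq' hpk' hn' hq
  omega

theorem rowLen_rectOfBox (p q r : ℕ) :
    (rectOfBox (p, q)).rowLen r = if r ≤ p then q + 1 else 0 := by
  have h : ∀ j, j < (rectOfBox (p, q)).rowLen r ↔ r ≤ p ∧ j ≤ q := fun j => by
    rw [← YoungDiagram.mem_iff_lt_rowLen, ← YoungDiagram.mem_cells]
    simp [rectOfBox]
  apply Nat.le_antisymm
  · by_contra hlt
    rw [not_le, h] at hlt
    split_ifs at hlt <;> omega
  · split_ifs with hr
    · exact (h q).2 ⟨hr, le_rfl⟩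
    · exact Nat.zero_le _

theorem verticalSteps_rectOfBox {n k p q : ℕ} (hp : p < k) :
    verticalSteps n k (rectOfBox (p, q)) = rectLabel n k (p + 1) (q + 1) := by
  ext i
  simp only [verticalSteps, rowLen_rectOfBox, Set.mem_ofPred_eq, mem_rectLabel]
  constructor
  · rintro ⟨r, hr, h⟩
    split_ifs at h <;> omega
  · rintro (h | ⟨h1, h2⟩)
    -- A north step below the rectangle: its row is empty, so solve i = k - 1 - r.
    · refine ⟨k - 1 - i, by omega, ?_⟩
      rw [if_neg (by omega)]
      omega
    -- A north step along the rectangle: its row has q + 1 boxes, so solve i = (q + 1) + (k - 1 -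
    -- r).
    · refine ⟨k + q - i, by omega, ?_⟩
      rw [if_pos (by omega)]
      omega

namespace PlabicGraph

variable {n : ℕ}

/-! ### Growing the diagram box by box -/

/-- The graph `G` with its trip labelling arises by adding the bridges of the boxes in `S`. -/
structure IsBridgeStage (k : ℕ) (S : Set (ℕ × ℕ)) (G : PlabicGraph n) (π : Equiv.Perm (Fin n))
    (tgt : G.Dart → Fin n) (lab : G.Dart → Set (Fin n)) : Prop
    extends IsTripLabelling k G π tgt lab where
  row : ∀ p q (i : Fin n), p < k → (p, q) ∉ S → (∀ q' < q, (p, q') ∈ S) →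
    (i : ℕ) + p + 1 = k + q → (π i : ℕ) + p + 1 = k
  col : ∀ p q (i : Fin n), (p, q) ∉ S → (∀ p' < p, (p', q) ∈ S) →
    (i : ℕ) + p = k + q → (π i : ℕ) = k + q
  arc : ∀ p q (i : Fin n), (p, q) ∉ S → (0 < p → 0 < q → (p - 1, q - 1) ∈ S) →
    (i : ℕ) + p + 1 = k + q → lab (G.bdry i) = rectLabel n k p q
  range_lab : Set.range lab = insert (initialSegment n k : Set (Fin n))
    {T | ∃ b ∈ S, T = rectLabel n k (b.1 + 1) (b.2 + 1)}
  untouched : ∀ i j : Fin n, (∀ b ∈ S, (i : ℕ) + b.1 + 1 ≠ k + b.2) →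
    (∀ b ∈ S, (j : ℕ) + b.1 + 1 ≠ k + b.2) → G.leftFace (G.bdry i) = G.leftFace (G.bdry j)

theorem lollipopGraph_isBridgeStage (n k : ℕ) (hn : 0 < n) :
    IsBridgeStage k ∅ (lollipopGraph n k) 1 (fun d => d.1)
      (fun _ => (initialSegment n k : Set (Fin n))) where
  toIsTripLabelling := lollipopGraph_isTripLabelling n k
  row p q i _ _ hq h := by
    rcases Nat.eq_zero_or_pos q with rfl | hq0
    · simpa using h
    · exact absurd (hq 0 hq0) (Set.notMem_empty _)
  col p q i _ hp h := by
    rcases Nat.eq_zero_or_pos p with rfl | hp0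
    · simpa using h
    · exact absurd (hp 0 hp0) (Set.notMem_empty _)
  arc p q i _ hpq _ := by
    rw [rectLabel_of_eq_zero]
    by_contra! h
    exact hpq (Nat.pos_of_ne_zero h.1) (Nat.pos_of_ne_zero h.2)
  range_lab := by
    have : Nonempty (lollipopGraph n k).Dart := ⟨((⟨0, hn⟩, true) : Fin n × Bool)⟩
    rw [Set.range_const]
    simp
  untouched i j _ _ := lollipopGraph_leftFace_eq n k i j true true

theorem newLabel_eq_rectLabel {G : PlabicGraph n} {a b : Fin n} {k r c : ℕ}
    {π : Equiv.Perm (Fin n)} {lab : G.Dart → Set (Fin n)}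
    (hlab : lab (G.bdry a) = rectLabel n k r c) (ha : (π a : ℕ) + r + 1 = k)
    (hb : (π b : ℕ) = k + c) : newLabel a b π lab = rectLabel n k (r + 1) (c + 1) := by
  ext t
  simp only [newLabel, hlab, Set.mem_ofPred_eq, mem_rectLabel, Fin.ext_iff, ne_eq]
  omega

namespace IsBridgeStage

variable {k : ℕ} {S : Set (ℕ × ℕ)} {G : PlabicGraph n} {π : Equiv.Perm (Fin n)}
  {tgt : G.Dart → Fin n} {lab : G.Dart → Set (Fin n)}

/-- Here a is an antiexcedance or a white fixed point, so its value is at least n, while b is an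
excedance or a black fixed point, with value below n. -/
theorem affineValue_lt (H : IsTripLabelling k G π tgt lab) {a b : Fin n} (ha : π a ≤ a)
    (hak : (π a : ℕ) < k) (hb : b ≤ π b) (hbk : k ≤ (π b : ℕ)) :
    G.affineValue b (π b) < G.affineValue a (π a) := by
  have h1 : G.affineValue b (π b) = π b := by
    refine if_pos ?_
    rcases hb.lt_or_eq with h | h
    · exact Or.inl h
    · refine Or.inr ⟨h, ?_⟩
      rw [← Bool.not_eq_true, H.white_of_fixed b h.symm, h]
      omega
  have h2 : G.affineValue a (π a) = π a + n := by
    refine if_neg ?_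
    rintro (h | ⟨h, hw⟩)
    · exact absurd h (not_lt.2 ha)
    · rw [← Bool.not_eq_true, H.white_of_fixed a h.symm] at hw
      rw [h] at hw
      exact hw hak
  rw [h1, h2]
  omega

/-- As (r, c) is the first free box of its row, its column and its diagonal, the invariants give
π(a), π(b) and the label at the arc from a to b. Restoring them concerns only this row, column and
diagonal. -/
theorem insert_box (H : IsBridgeStage k S G π tgt lab) (hS : IsLowerSet S) {r c : ℕ}
    (hr : r < k) (hc : k + c < n) (hrc : (r, c) ∉ S) (hlt : ∀ b < (r, c), b ∈ S)
    {a b : Fin n} (ha : (a : ℕ) + r + 1 = k + c) (hb : (b : ℕ) = a + 1) :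
    G.IsValidBridge a b ∧ ∃ π' tgt' lab',
      IsBridgeStage k (insert (r, c) S) (G.addBridge a b) π' tgt' lab' := by
  have hrow : ∀ q' < c, (r, q') ∈ S := fun q' h => hlt _ (Prod.mk_lt_mk_iff_right.2 h)
  have hcol : ∀ p' < r, (p', c) ∈ S := fun p' h => hlt _ (Prod.mk_lt_mk_iff_left.2 h)
  have hdiag : 0 < r → 0 < c → (r - 1, c - 1) ∈ S := fun h1 h2 =>
    hlt _ (Prod.mk_lt_mk.2 (Or.inl ⟨by omega, by omega⟩))
  have hπa : (π a : ℕ) + r + 1 = k := H.row r c a hr hrc hrow ha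
  have hπb : (π b : ℕ) = k + c := H.col r c b hrc hcol (by omega)
  have hlab := H.arc r c a hrc hdiag ha
  have hne : a ≠ b := by
    intro h
    rw [h] at hb
    omega
  have hwa : G.IsLollipop a → G.white (G.nbr a) = true := fun h => by
    have hf := H.fixed_of_isLollipop h
    rw [H.white_of_fixed a hf]
    rw [hf] at hπa
    omega
  have hwb : G.IsLollipop b → G.white (G.nbr b) = false := fun h => by
    have hf := H.fixed_of_isLollipop h
    rw [← Bool.not_eq_true, H.white_of_fixed b hf]
    rw [hf] at hπb
    omega
  have hrot : finRotate n a = b := by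
    cases n with
    | zero => exact a.elim0
    | succ m =>
      rw [Fin.ext_iff, hb]
      exact coe_finRotate_of_ne_last fun h => by
        rw [h, Fin.val_last] at hb
        omega
  refine ⟨⟨Fin.lt_def.2 (by omega), ⟨π a, π b, (H.tripEndsAt_iff _ _).2 rfl,
    (H.tripEndsAt_iff _ _).2 rfl, affineValue_lt H.toIsTripLabelling (Fin.le_def.2 (by omega))
    (by omega) (Fin.le_def.2 (by omega)) (by omega)⟩, fun i h1 h2 => ?_, hwa, hwb⟩, ?_⟩
  · rw [Fin.lt_def] at h1 h2
    omega
  obtain ⟨tgt', lab', H', harc, harca, hrange, hface⟩ := H.toIsTripLabelling.addBridge hrot hne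
    (fun h => by rw [h] at hπa; omega) (fun h => by rw [h] at hπb; omega) hwa hwb
  have hnew := newLabel_eq_rectLabel (lab := lab) hlab hπa hπb
  refine ⟨π * Equiv.swap a b, tgt', lab', H', ?_, ?_, ?_, ?_, ?_⟩
  · intro p q i hp hpq hq hi
    simp only [Set.mem_insert_iff, Prod.mk.injEq, not_or] at hpq hq
    by_cases hpr : p = r
    · subst hpr
      -- In row r the first free box moves to (r, c + 1), whose vertex is b, and b has just received
      -- the target of a.
      have h1 : c < q := by
        by_contra h
        exact hpq.2 (hrow q (by omega))
      have h2 : q = c + 1 := by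
        by_contra h
        have h3 := (hq (c + 1) (by omega)).resolve_left (by omega)
        exact hrc (hS (Prod.mk_le_mk.2 ⟨le_rfl, Nat.le_succ c⟩) h3)
      have h3 : i = b := Fin.ext (by omega)
      rwa [h3, IsBridgeable.perm_b]
    · have h1 := H.row p q i hp hpq.2
        (fun q' h => (hq q' h).resolve_left fun h => hpr h.1) hi
      -- The target of i is k - p - 1, which differs from the target k - r - 1 of a and from the
      -- target k + c of b, so the swap does not move i.
      rwa [IsBridgeable.perm_of_ne]
      · rintro rfl
        omega
      · rintro rfl
        omega
  · intro p q i hpq hp hi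
    simp only [Set.mem_insert_iff, Prod.mk.injEq, not_or] at hpq hp
    by_cases hqc : q = c
    · subst hqc
      have h1 : r < p := by
        by_contra h
        exact hpq.2 (hcol p (by omega))
      have h2 : p = r + 1 := by
        by_contra h
        have h3 := (hp (r + 1) (by omega)).resolve_left (by omega)
        exact hrc (hS (Prod.mk_le_mk.2 ⟨Nat.le_succ r, le_rfl⟩) h3)
      have h3 : i = a := Fin.ext (by omega)
      rwa [h3, IsBridgeable.perm_a]
    · have h1 := H.col p q i hpq.2
        (fun p' h => (hp p' h).resolve_left fun h => hqc h.2) hi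
      rwa [IsBridgeable.perm_of_ne]
      · rintro rfl
        omega
      · rintro rfl
        omega
  · intro p q i hpq hpq' hi
    simp only [Set.mem_insert_iff, Prod.mk.injEq, not_or] at hpq hpq'
    by_cases hia : i = a
    · subst hia
      -- On the diagonal of (r, c) the first free box is now (r + 1, c + 1).
      have h1 : r < p := by
        by_contra h
        exact hpq.2 (hlt _ (lt_of_le_of_ne (Prod.mk_le_mk.2 ⟨by omega, by omega⟩)
          fun h => hpq.1 (Prod.mk.inj h)))
      have h2 : p = r + 1 := by
        rcases hpq' (by omega) (by omega) with h | h
        · omega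
        · by_contra h3
          exact hrc (hS (Prod.mk_le_mk.2 ⟨by omega, by omega⟩) h)
      have h3 : q = c + 1 := by omega
      rw [harca, hnew, h2, h3]
    · rw [harc i hia]
      refine H.arc p q i hpq.2 (fun h1 h2 => (hpq' h1 h2).resolve_left ?_) hi
      rintro ⟨h3, h4⟩
      exact hia (Fin.ext (by omega))
  · rw [hrange, hnew, H.range_lab]
    ext T
    simp only [Set.mem_insert_iff, Set.mem_ofPred_eq, exists_eq_or_imp]
    tauto
  · intro i j hi hj
    have hne : ∀ i : Fin n, (∀ b ∈ insert (r, c) S, (i : ℕ) + b.1 + 1 ≠ k + b.2) → i ≠ a := by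
      rintro i h rfl
      exact h _ (Set.mem_insert _ _) ha
    exact hface i j (hne i hi) (hne j hj) (H.untouched i j
      (fun b hb => hi b (Set.mem_insert_of_mem _ hb))
      (fun b hb => hj b (Set.mem_insert_of_mem _ hb)))

end IsBridgeStage

end PlabicGraph

/-! ### The columnar reading -/

/-- The boxes of `μ`, read down the columns, columns from left to right. -/
def columnarBoxes (μ : YoungDiagram) : List (ℕ × ℕ) :=
  (List.range (μ.rowLen 0)).flatMap fun c => (List.range (μ.colLen c)).map fun r => (r, c)

theorem columnarReading_eq_map (k : ℕ) (μ : YoungDiagram) :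
    columnarReading k μ = (columnarBoxes μ).map fun b => k + b.2 - (b.1 + 1) := by
  simp [columnarReading, columnarBoxes, List.map_flatMap, Function.comp_def]

theorem mem_columnarBoxes {μ : YoungDiagram} {b : ℕ × ℕ} : b ∈ columnarBoxes μ ↔ b ∈ μ := by
  obtain ⟨r, c⟩ := b
  simp only [columnarBoxes, List.mem_flatMap, List.mem_range, List.mem_map, Prod.mk.injEq]
  constructor
  · rintro ⟨c', -, r', hr, rfl, rfl⟩
    exact YoungDiagram.mem_iff_lt_colLen.2 hr
  · intro h
    exact ⟨c, YoungDiagram.mem_iff_lt_rowLen.1 (μ.up_left_mem (Nat.zero_le r) le_rfl h), r,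
      YoungDiagram.mem_iff_lt_colLen.1 h, rfl, rfl⟩

/-- The columnar reading is a linear extension of the order on boxes: no box precedes one that lies
weakly northwest of it. -/
theorem pairwise_columnarBoxes (μ : YoungDiagram) :
    (columnarBoxes μ).Pairwise fun b b' => ¬ b' ≤ b := by
  rw [columnarBoxes, List.pairwise_flatMap]
  refine ⟨fun c _ => ?_, ?_⟩
  · rw [List.pairwise_map]
    refine List.pairwise_lt_range.imp fun h h' => ?_
    exact absurd (Prod.mk_le_mk.1 h').1 (not_le.2 h)
  · refine List.pairwise_lt_range.imp fun h => ?_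
    simp only [List.mem_map, List.mem_range]
    rintro _ ⟨r, -, rfl⟩ _ ⟨r', -, rfl⟩ h'
    exact absurd (Prod.mk_le_mk.1 h').2 (not_le.2 h)

theorem columnarBoxes_prefix {μ : YoungDiagram} {l : List (ℕ × ℕ)} {b : ℕ × ℕ}
    (h : l ++ [b] <+: columnarBoxes μ) : b ∈ μ ∧ b ∉ l ∧ ∀ b' < b, b' ∈ l := by
  obtain ⟨t, ht⟩ := h
  have hp := pairwise_columnarBoxes μ
  have hmem : ∀ b', b' ∈ μ ↔ (b' ∈ l ∨ b' = b) ∨ b' ∈ t := fun b' => by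
    rw [← mem_columnarBoxes, ← ht]
    simp [or_assoc]
  have hb : b ∈ μ := (hmem b).2 (Or.inl (Or.inr rfl))
  rw [← ht, List.pairwise_append, List.pairwise_append] at hp
  refine ⟨hb, fun hl => ?_, fun b' hlt => ?_⟩
  · exact hp.1.2.2 b hl b (List.mem_singleton_self b) le_rfl
  · rcases (hmem b').1 (μ.isLowerSet hlt.le hb) with (h | h) | h
    · exact h
    · exact absurd h hlt.ne
    · exact absurd hlt.le (hp.2.2 b (by simp) b' h)

theorem isLowerSet_columnarBoxes_prefix {μ : YoungDiagram} {l : List (ℕ × ℕ)}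
    (h : l <+: columnarBoxes μ) : IsLowerSet {b | b ∈ l} := by
  intro b b' hle hb
  obtain ⟨l₁, l₂, rfl⟩ := List.append_of_mem (show b ∈ l from hb)
  have h1 : l₁ ++ [b] <+: columnarBoxes μ := List.IsPrefix.trans ⟨l₂, by simp⟩ h
  rcases hle.lt_or_eq with hlt | rfl
  · exact List.mem_append_left _ ((columnarBoxes_prefix h1).2.2 b' hlt)
  · exact hb

/-! ### Stages along the columnar reading, and boundary faces -/

namespace PlabicGraph

variable {n k : ℕ} {μ : YoungDiagram}

theorem ofBridgeSequence_append (n k : ℕ) (l : List ℕ) {j : ℕ} (h : j + 1 < n) :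
    ofBridgeSequence n k (l ++ [j]) =
      (ofBridgeSequence n k l).addBridge ⟨j, by omega⟩ ⟨j + 1, h⟩ := by
  rw [ofBridgeSequence, List.foldl_append]
  exact dif_pos h

theorem exists_isBridgeStage (hn : 0 < n) (hμ : ∀ b ∈ μ, b.1 < k ∧ k + b.2 < n)
    (l : List (ℕ × ℕ)) (hl : l <+: columnarBoxes μ) :
    ∃ π tgt lab, IsBridgeStage k {b | b ∈ l}
      (ofBridgeSequence n k (l.map fun b => k + b.2 - (b.1 + 1))) π tgt lab := by
  induction l using List.reverseRecOn with
  | nil =>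
    have h : {b : ℕ × ℕ | b ∈ ([] : List (ℕ × ℕ))} = ∅ := by ext; simp
    rw [h]
    exact ⟨_, _, _, lollipopGraph_isBridgeStage n k hn⟩
  | append_singleton l b ih =>
    have hl' : l <+: columnarBoxes μ := (List.prefix_append l [b]).trans hl
    obtain ⟨π, tgt, lab, H⟩ := ih hl'
    obtain ⟨hb, hbl, hlt⟩ := columnarBoxes_prefix hl
    obtain ⟨hr, hc⟩ := hμ b hb
    have hj : k + b.2 - (b.1 + 1) + 1 < n := by omega
    have h : {b' | b' ∈ l ++ [b]} = insert b {b' | b' ∈ l} := by ext; simp [or_comm]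
    rw [List.map_append, List.map_singleton, ofBridgeSequence_append _ _ _ hj, h]
    exact (H.insert_box (isLowerSet_columnarBoxes_prefix hl') hr hc hbl hlt
      (by dsimp only; omega) rfl).2

theorem isBridgeSequence_columnarReading (hn : 0 < n) (hμ : ∀ b ∈ μ, b.1 < k ∧ k + b.2 < n) :
    IsBridgeSequence n k (columnarReading k μ) := by
  intro l' j h
  rw [columnarReading_eq_map, List.prefix_map_iff] at h
  obtain ⟨l, hl, hmap⟩ := h
  obtain ⟨l₁, l₂, rfl, rfl, h2⟩ := List.map_eq_append_iff.1 hmap.symm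
  obtain ⟨b, rfl, rfl⟩ := List.map_eq_singleton_iff.1 h2
  have hl' : l₁ <+: columnarBoxes μ := (List.prefix_append l₁ [b]).trans hl
  obtain ⟨π, tgt, lab, H⟩ := exists_isBridgeStage hn hμ l₁ hl'
  obtain ⟨hb, hbl, hlt⟩ := columnarBoxes_prefix hl
  obtain ⟨hr, hc⟩ := hμ b hb
  refine ⟨by omega, ?_⟩
  exact (H.insert_box (isLowerSet_columnarBoxes_prefix hl') hr hc hbl hlt
    (by dsimp only; omega) rfl).1

/-- Each diagonal has a first box outside the diagram. -/
theorem exists_first_box_notMem (hμ : ∀ b ∈ μ, b.1 < k ∧ k + b.2 < n) (i : ℕ) :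
    ∃ p q, i + p + 1 = k + q ∧ (p, q) ∉ μ ∧ (0 < p → 0 < q → (p - 1, q - 1) ∈ μ) := by
  -- By truncated subtraction m = 0 is the top left box of the diagonal, with one coordinate zero; m
  -- = k has left the k rows.
  have hex : ∃ m, (k - 1 - i + m, i + 1 - k + m) ∉ μ :=
    ⟨k, fun h => absurd (hμ _ h).1 (by dsimp only; omega)⟩
  classical
  refine ⟨k - 1 - i + Nat.find hex, i + 1 - k + Nat.find hex, by omega,
    Nat.find_spec hex, fun h1 h2 => ?_⟩
  have h3 : 0 < Nat.find hex := by omega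
  have h4 := Nat.find_min hex (m := Nat.find hex - 1) (by omega)
  rw [not_not] at h4
  convert h4 using 2
  all_goals omega

theorem IsBridgeStage.range_targetLabel_and_bijOn {G : PlabicGraph n} {π : Equiv.Perm (Fin n)}
    {tgt : G.Dart → Fin n} {lab : G.Dart → Set (Fin n)}
    (H : IsBridgeStage k {b | b ∈ μ} G π tgt lab) (hn : 0 < n) (hk : k ≤ n)
    (hμ : ∀ b ∈ μ, b.1 < k ∧ k + b.2 < n) :
    Set.range G.targetLabel = {S | ∃ b ∈ μ, S = verticalSteps n k (rectOfBox b)} ∪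
        {(initialSegment n k : Set (Fin n))} ∧
    Set.BijOn G.targetLabel G.boundaryFaces
      ({S | ∃ b, IsFrozenBox μ b ∧ S = verticalSteps n k (rectOfBox b)} ∪
        {(initialSegment n k : Set (Fin n))}) := by
  have hrect : ∀ b ∈ μ, verticalSteps n k (rectOfBox b) = rectLabel n k (b.1 + 1) (b.2 + 1) :=
    fun b hb => verticalSteps_rectOfBox (hμ b hb).1
  have harc : ∀ p q (i : Fin n), (i : ℕ) + p + 1 = k + q → (p, q) ∉ μ →
      (0 < p → 0 < q → (p - 1, q - 1) ∈ μ) →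
      G.targetLabel (G.leftFace (G.bdry i)) = rectLabel n k p q := fun p q i hi h1 h2 => by
    rw [H.targetLabel_leftFace]
    exact H.arc p q i h1 h2 hi
  have hlab : ∀ d, G.targetLabel (G.leftFace d) = lab d := H.targetLabel_leftFace
  have hfrozen : ∀ {p q}, (p, q) ∉ μ → 0 < p → 0 < q → (p - 1, q - 1) ∈ μ →
      IsFrozenBox μ (p - 1, q - 1) := by
    intro p q h hp hq hm
    refine ⟨hm, ?_⟩
    dsimp only
    rwa [Nat.sub_add_cancel hp, Nat.sub_add_cancel hq]
  refine ⟨?_, ?_, ?_, ?_⟩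
  · have h1 : Set.range G.targetLabel = Set.range lab := by
      apply Set.Subset.antisymm
      · rintro _ ⟨f, rfl⟩
        obtain ⟨d, rfl⟩ := Quot.exists_rep f
        exact ⟨d, (hlab d).symm⟩
      · rintro _ ⟨d, rfl⟩
        exact ⟨_, hlab d⟩
    rw [h1, H.range_lab, Set.insert_eq, Set.union_comm]
    congr 1
    ext T
    refine exists_congr fun b => and_congr_right fun hb => ?_
    rw [hrect b hb]
  · rintro _ ⟨i, rfl⟩
    obtain ⟨p, q, hi, hpq, hm⟩ := exists_first_box_notMem hμ i
    change G.targetLabel (G.leftFace (G.bdry i)) ∈ _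
    rw [harc p q i hi hpq hm]
    by_cases h : 0 < p ∧ 0 < q
    · refine Or.inl ⟨(p - 1, q - 1), hfrozen hpq h.1 h.2 (hm h.1 h.2), ?_⟩
      rw [hrect _ (hm h.1 h.2), Nat.sub_add_cancel h.1, Nat.sub_add_cancel h.2]
    · exact Or.inr (rectLabel_of_eq_zero (by omega))
  · rintro _ ⟨i, rfl⟩ _ ⟨j, rfl⟩ h
    obtain ⟨p, q, hi, hpq, hm⟩ := exists_first_box_notMem hμ i
    obtain ⟨p', q', hj, hpq', hm'⟩ := exists_first_box_notMem hμ j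
    change G.targetLabel (G.leftFace (G.bdry i)) = G.targetLabel (G.leftFace (G.bdry j)) at h
    change G.leftFace (G.bdry i) = G.leftFace (G.bdry j)
    rw [harc p q i hi hpq hm, harc p' q' j hj hpq' hm'] at h
    have bound : ∀ {p q}, 0 < p → 0 < q → (p - 1, q - 1) ∈ μ → p ≤ k ∧ k + q ≤ n := by
      intro p q h1 h2 h3
      have := hμ _ h3
      dsimp only at this
      omega
    have empty : ∀ {p q} {i : Fin n}, (i : ℕ) + p + 1 = k + q → (p, q) ∉ μ → ¬ (0 < p ∧ 0 < q) →
        ∀ b ∈ μ, (i : ℕ) + b.1 + 1 ≠ k + b.2 := by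
      -- If the first free box of a diagonal has a zero coordinate, it lies weakly northwest of all
      -- boxes on that diagonal, so the diagonal misses μ.
      intro p q i hi hpq h b hb hib
      exact hpq (μ.up_left_mem (by omega) (by omega) hb)
    by_cases h1 : 0 < p ∧ 0 < q
    · have b1 := bound h1.1 h1.2 (hm h1.1 h1.2)
      by_cases h2 : 0 < p' ∧ 0 < q'
      · have b2 := bound h2.1 h2.2 (hm' h2.1 h2.2)
        have h3 := rectLabel_injective h h1.1 h1.2 b1.1 b1.2 h2.1 h2.2 b2.1 b2.2
        rw [show i = j from Fin.ext (by omega)]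
      · rw [rectLabel_of_eq_zero (p := p') (by omega)] at h
        exact absurd h (rectLabel_ne_initialSegment h1.1 h1.2 b1.2)
    · by_cases h2 : 0 < p' ∧ 0 < q'
      · have b2 := bound h2.1 h2.2 (hm' h2.1 h2.2)
        rw [rectLabel_of_eq_zero (p := p) (by omega)] at h
        exact absurd h.symm (rectLabel_ne_initialSegment h2.1 h2.2 b2.2)
      · exact H.untouched i j (empty hi hpq h1) (empty hj hpq' h2)
  · rintro T (⟨⟨r, c⟩, hb, rfl⟩ | rfl)
    · have hbd := hμ _ hb.1
      dsimp only at hbd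
      refine ⟨_, ⟨⟨k + c - (r + 1), by omega⟩, rfl⟩, ?_⟩
      change G.targetLabel (G.leftFace (G.bdry _)) = _
      rw [hrect _ hb.1]
      exact harc (r + 1) (c + 1) _ (by dsimp only; omega) hb.2 fun _ _ => hb.1
    -- The arc from the last boundary vertex back to the first: its diagonal starts at (0, n - k),
    -- outside the rectangle.
    · refine ⟨_, ⟨⟨n - 1, by omega⟩, rfl⟩, ?_⟩
      change G.targetLabel (G.leftFace (G.bdry _)) = _
      rw [harc 0 (n - k) _ (by dsimp only; omega) ?_ (fun h => absurd h (lt_irrefl 0)),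
        rectLabel_of_eq_zero (Or.inl rfl)]
      intro h
      have := (hμ _ h).2
      dsimp only at this
      omega

end PlabicGraph

/-! ### From the reduced expression to the columnar reading -/

theorem card_initialSegment {n k : ℕ} (hk : k ≤ n) : (initialSegment n k).card = k := by
  rw [initialSegment, Fin.card_filter_val_lt, min_eq_right hk]

/-- The path has k north steps, which bounds the rows, and n - k east steps, which bounds the
columns. -/
theorem bounds_of_mem_diagramOfPerm {n k : ℕ} (hk : k ≤ n) (x : Equiv.Perm (Fin n)) {b : ℕ × ℕ}
    (hb : b ∈ diagramOfPerm k x) : b.1 < k ∧ k + b.2 < n := by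
  have hb' := (YoungDiagram.mem_cells _).2 hb
  simp only [diagramOfPerm, diagramOfSubset, Finset.mem_filter] at hb'
  set I := (initialSegment n k).image x
  have hI : I.card = k := by
    rw [Finset.card_image_of_injective _ x.injective, card_initialSegment hk]
  have h := hb'.2
  have h1 := h.trans_le (Finset.card_filter_le _ _)
  obtain ⟨i, hi⟩ := Finset.card_pos.1 ((Nat.zero_le _).trans_lt h)
  have h2 := (Finset.mem_filter.1 hi).2
  have h3 : (Finset.univ.filter fun m => m ∉ I ∧ m < i).card ≤ Iᶜ.card :=
    Finset.card_le_card fun m hm => Finset.mem_compl.2 (Finset.mem_filter.1 hm).2.1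
  rw [Finset.card_compl, Fintype.card_fin, hI] at h3
  omega

/-- All reduced expressions for w_K have length ℓ(w_K), so dropping that many letters leaves exactly
the columnar expression, whose reversal is the reading. -/
theorem bridgeSequence_eq_columnarReading {n k : ℕ} {x wK w : Equiv.Perm (Fin n)} {ws : List ℕ}
    (hws : IsStandardReducedExpression k x wK w ws) :
    bridgeSequence wK ws = columnarReading k (diagramOfPerm k x) := by
  obtain ⟨-, us, ⟨-, -, hus⟩, rfl⟩ := hws
  rw [bridgeSequence, List.rdrop_append_of_le_length _ hus.ge, List.rdrop_eq_reverse_drop_reverse]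
  simp [← hus, columnarExpression]

theorem mainTheorem9 (n k : ℕ) (hn : 0 < n) (hk : k ≤ n)
    (wK x w : Equiv.Perm (Fin n)) (hwK : IsLongestParabolic n k wK)
    (hx : IsMinimalCosetRep n k x) (hw : w = x * wK)
    (hlen : permLength w = permLength x + permLength wK)
    (ws : List ℕ) (hws : IsStandardReducedExpression k x wK w ws) :
    PlabicGraph.IsBridgeSequence n k (bridgeSequence wK ws) ∧
    Set.range (bridgeGraph k wK ws).targetLabel =
      {S | ∃ b ∈ diagramOfPerm k x, S = verticalSteps n k (rectOfBox b)} ∪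
        {(initialSegment n k : Set (Fin n))} ∧
    Set.BijOn (bridgeGraph k wK ws).targetLabel (bridgeGraph k wK ws).boundaryFaces
      ({S | ∃ b, IsFrozenBox (diagramOfPerm k x) b ∧ S = verticalSteps n k (rectOfBox b)} ∪
        {(initialSegment n k : Set (Fin n))}) := by
  have hμ : ∀ b ∈ diagramOfPerm k x, b.1 < k ∧ k + b.2 < n := fun b hb =>
    bounds_of_mem_diagramOfPerm hk x hb
  rw [bridgeGraph, bridgeSequence_eq_columnarReading hws]
  have hseq := PlabicGraph.isBridgeSequence_columnarReading hn hμ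
  rw [columnarReading_eq_map] at hseq ⊢
  obtain ⟨π, tgt, lab, H⟩ := PlabicGraph.exists_isBridgeStage hn hμ _ (List.prefix_refl _)
  simp only [mem_columnarBoxes] at H
  exact ⟨hseq, H.range_targetLabel_and_bijOn hn hk hμ⟩
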